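/- **Setting.** Let $\Xi=(\Xi_1,\dots,\Xi_d)$ have independent coordinates, with joint law $\rho$ on a domain $\Omega\subset\mathbb R^d$. For each $i$ let $(\psi^{(i)}_n)_{n\ge 0}$ be polynomials, $\deg\psi^{(i)}_n=n$, orthonormal for the law of $\Xi_i$, and put $\psi_{\mathbf k}(\xi)=\prod_i\psi^{(i)}_{k_i}(\xi_i)$ for $\mathbf k\in\mathbb N_0^d$. Let $u$ be measurable with $0<\mathbb E\,u(\Xi)^2<\infty$ and $u=\sum_{\mathbf k}c_{\mathbf k}\psi_{\mathbf k}$ in mean square, where $c_{\mathbf k}=\mathbb E(u(\Xi)\psi_{\mathbf k}(\Xi))$. Write $\mathrm{RMSE}(v)=(\mathbb E(v(\Xi)-u(\Xi))^2)^{1/2}$ and $\mathrm{RRMSE}(v)=\mathrm{RMSE}(v)/(\mathbb E\,u(\Xi)^2)^{1/2}$. A basis $\mathcal B$ is a finite set of multi-indices. For $\mathbf p\in[0,\infty)^d$ the anisotropic order basis of order $\mathbf p$ is $\{\mathbf k:\sum_i k_i/p_i\le 1\}$ (with $k_i=0$ forced where $p_i=0$). Let $\tilde u_{\mathcal B}=\sum_{\mathbf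 k\in\mathcal B}\tilde c_{\mathbf k}\psi_{\mathbf k}$ denote the element of the span of $\mathcal B$ of least RRMSE. At an iteration of the method there are a basis $\mathcal B_k$ with $|\mathcal B_k|\ge2$, a number $N_k$ of samples $\xi^{(1)},\dots,\xi^{(N_k)}$ with an arbitrary joint law, and a positive measurable weight $w$. Let $W=N_k^{-1/2}\,\mathrm{diag}(w(\xi^{(i)}))$, $\Psi=(\psi_{\mathbf k}(\xi^{(i)}))_{i,\,\mathbf k\in\mathcal B_k}$, $\mathbf u=(u(\xi^{(i)}))_i$ and $D=W\Psi$. For $\Lambda>0$, a *computed surrogate* is $\hat u_k=\sum_{\mathbf k\in\mathcal B_k}\hat c_{\mathbf k}\psi_{\mathbf k}$, where $\hat c$ minimizes $\|c\|_1$ subject to $\|W(\mathbf u-\Psi c)\|_2\le\delta\|W\mathbf u\|_2$ and the tolerance $\delta$ is at the noise level: $$\|W(\mathbf u-\Psi\tilde c)\|_2\le\delta\|W\mathbf u\|_2\le\Lambda\,\mathrm{RMSE}(\tilde u_{\mathcal B_k}).$$ Fix $0<t_0<t$, $\beta\ge0$ and a function $\kappa:\tau\mapsto\kappa_\tau$ with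 $\kappa_\tau>0$ on $[t_0,t]$. The iteration is *non-sparse-coupled* (with $t_0,\beta,\kappa$) if there are i.i.d. samples $\xi_\star^{(1)},\dots,\xi_\star^{(N_k)}$ from a probability distribution on $\Omega$, with a positive measurable weight $w_\star$ and design matrix $D_\star$ (formed with $w_\star$ in the same way), such that $\mathbb E(w_\star^2\psi_{\mathbf k}\psi_{\mathbf l})=\delta_{\mathbf k\mathbf l}$ under that distribution for $\mathbf k,\mathbf l\in\mathcal B_k$ and $\mu_\star(|\mathcal B_k|)=\sup_{\xi\in\Omega}\sum_{\mathbf k\in\mathcal B_k}|w_\star(\xi)\psi_{\mathbf k}(\xi)|^2<\infty$, and a joint law of the two sample pools with, for all $\tau\in[t_0,t]$, $$\mathbb P\big(\|D^TD-D_\star^TD_\star\|>\tau\big)\le\beta\exp\big(-\kappa_\tau N_k\,\mu_\star(|\mathcal B_k|)^{-1}\log^{-1}|\mathcal B_k|\big).$$ Put $\beta_\star=\max(\beta,1)$. **Statement.** Let $0<t<3/(4+\sqrt6)$. There are $\kappa'_t>0$ depending only on $t,t_0,\beta,\kappa$ and $\nu_0>0$ depending only on $t,B,\alpha,\mathbb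 E\,u(\Xi)^2,\Lambda$ (for $B,\alpha>0$), in particular both independent of the dimension $d$, such that the following holds. (1) At every non-sparse-coupled iteration, $\mathbb P(\|D^TD-I\|>t)\le2\beta_\star\exp(-\kappa'_tN_k\,\mu_\star(|\mathcal B_k|)^{-1}\log^{-1}|\mathcal B_k|)$. (2) Suppose $|c_{\mathbf i}|\le B\exp(-\alpha\sum_{j=1}^dj^2i_j)$ for all $\mathbf i\in\mathbb N_0^d$, and let $\epsilon\in(0,0.9)$. Then there is an anisotropic order basis $\mathcal B_\epsilon$ with $|\mathcal B_\epsilon|\le\epsilon^{-\nu_0}$ and $\mathrm{RRMSE}(\tilde u_{\mathcal B_\epsilon})\le\epsilon$ such that for every $\nu\ge\nu_0$, every $C\in\mathbb R$ and every non-sparse-coupled iteration with $\mathcal B_\epsilon\subset\mathcal B_k$, $|\mathcal B_k|\le\epsilon^{-\nu}$ and $$N_k\ge-\nu\log(\epsilon)\,(C+\log(2\beta_\star))\,(\kappa'_t)^{-1}\mu_\star(|\mathcal B_k|),$$ with probability at least $1-e^{-C}$ every computed surrogate satisfies $\mathrm{RRMSE}(\hat u_k)\le\epsilon$. -/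

import Mathlib

open MeasureTheory Filter Topology

noncomputable section

namespace PolyChaos

/-- A `d`-dimensional random input with independent coordinates: the marginal laws, for each
coordinate the orthonormal polynomials of that marginal (one of each degree), and the domain on
which the input lives. -/
structure InputModel (d : ℕ) where
  marginal : Fin d → Measure ℝ
  isProb : ∀ i, IsProbabilityMeasure (marginal i)
  poly : Fin d → ℕ → Polynomial ℝ
  degree_poly : ∀ i n, (poly i n).degree = n
  memLp_poly : ∀ i n, MemLp (fun x => (poly i n).eval x) 2 (marginal i)
  orthonormal : ∀ i m n,
    ∫ x, (poly i m).eval x * (poly i n).eval x ∂(marginal i) = if m = n then 1 else 0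
  domain : Set (Fin d → ℝ)
  measurableSet_domain : MeasurableSet domain
  domain_full : Measure.pi marginal domainᶜ = 0

attribute [instance] InputModel.isProb

variable {d : ℕ}

/-- The joint law of the input. -/
def InputModel.law (I : InputModel d) : Measure (Fin d → ℝ) := Measure.pi I.marginal

/-- The tensorized polynomial `ψ_k(ξ) = ∏ i, ψ_{k i}(ξ i)`. -/
def InputModel.psi (I : InputModel d) (k : Fin d → ℕ) (ξ : Fin d → ℝ) : ℝ :=
  ∏ i, (I.poly i (k i)).eval (ξ i)

/-- The exact projection coefficient `c_k = 𝔼 (u(Ξ) ψ_k(Ξ))`. -/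
def InputModel.coeff (I : InputModel d) (u : (Fin d → ℝ) → ℝ) (k : Fin d → ℕ) : ℝ :=
  ∫ ξ, u ξ * I.psi k ξ ∂I.law

/-- The function `u` equals its polynomial chaos expansion: the truncation error tends to zero in
mean square as basis functions are added. -/
def InputModel.HasExpansion (I : InputModel d) (u : (Fin d → ℝ) → ℝ) : Prop :=
  Tendsto (fun S : Finset (Fin d → ℕ) =>
    ∫ ξ, (u ξ - ∑ k ∈ S, I.coeff u k * I.psi k ξ) ^ 2 ∂I.law) atTop (𝓝 0)

/-- Multi-indices of the anisotropic total order basis of order `p`, that is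
`∑ i, k i / p i ≤ 1`; an order `p i = 0` forces `k i = 0`. -/
def anisoSet (p : Fin d → ℝ) : Set (Fin d → ℕ) :=
  {k | (∀ i, p i = 0 → k i = 0) ∧ ∑ i, (k i : ℝ) / p i ≤ 1}

theorem anisoSet_finite (p : Fin d → ℝ) (hp : ∀ i, 0 ≤ p i) : (anisoSet p).Finite := by
  refine (Set.Finite.pi' (fun i : Fin d => Set.finite_Iic ⌊p i⌋₊)).subset ?_
  rintro k ⟨h0, h1⟩ i
  rw [Set.mem_Iic]
  rcases (hp i).eq_or_lt with h | h
  · simp [h0 i h.symm]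
  · apply Nat.le_floor
    have h2 : (k i : ℝ) / p i ≤ ∑ j, (k j : ℝ) / p j :=
      Finset.single_le_sum (f := fun j => (k j : ℝ) / p j)
        (fun j _ => div_nonneg (Nat.cast_nonneg _) (hp j)) (Finset.mem_univ i)
    have h3 := h2.trans h1
    rwa [div_le_one h] at h3

/-- The anisotropic order basis, as a finite set of multi-indices. -/
def anisoBasis (p : Fin d → ℝ) (hp : ∀ i, 0 ≤ p i) : Finset (Fin d → ℕ) :=
  (anisoSet_finite p hp).toFinset

/-- The function `∑ k ∈ B, c k ψ_k`. -/
def InputModel.surrogate (I : InputModel d) (B : Finset (Fin d → ℕ)) (c : B → ℝ)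
    (ξ : Fin d → ℝ) : ℝ :=
  ∑ k : B, c k * I.psi k ξ

/-- Root-mean-square error of the approximation `v` of `u`. -/
def InputModel.rmse (I : InputModel d) (u v : (Fin d → ℝ) → ℝ) : ℝ :=
  √(∫ ξ, (v ξ - u ξ) ^ 2 ∂I.law)

/-- Relative root-mean-square error of the approximation `v` of `u`. -/
def InputModel.rrmse (I : InputModel d) (u v : (Fin d → ℝ) → ℝ) : ℝ :=
  I.rmse u v / √(∫ ξ, u ξ ^ 2 ∂I.law)

/-- The coefficients `c` give an approximation of `u` in the span of `B` of least RRMSE. -/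
def InputModel.IsBest (I : InputModel d) (u : (Fin d → ℝ) → ℝ) (B : Finset (Fin d → ℕ))
    (c : B → ℝ) : Prop :=
  ∀ c' : B → ℝ, I.rrmse u (I.surrogate B c) ≤ I.rrmse u (I.surrogate B c')

/-- The row scaling of the `i`th sample: its weight, divided by `√N` so that the Gram matrix of
the design matrix is normalized to have mean `1`. -/
def rowWeight {N : ℕ} (w : (Fin d → ℝ) → ℝ) (x : Fin N → Fin d → ℝ) (i : Fin N) : ℝ :=
  w (x i) / √(N : ℝ)

/-- The design matrix `D = W Ψ` of the basis `B`, the weight `w` and the samples `x`. -/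
def InputModel.design (I : InputModel d) {N : ℕ} (B : Finset (Fin d → ℕ))
    (w : (Fin d → ℝ) → ℝ) (x : Fin N → Fin d → ℝ) : Matrix (Fin N) B ℝ :=
  Matrix.of fun i k => rowWeight w x i * I.psi k (x i)

/-- The Gram matrix `Dᵀ D`. -/
def InputModel.gram (I : InputModel d) {N : ℕ} (B : Finset (Fin d → ℕ))
    (w : (Fin d → ℝ) → ℝ) (x : Fin N → Fin d → ℝ) : Matrix B B ℝ :=
  (I.design B w x).transpose * I.design B w x

/-- The operator norm of a square matrix with respect to the Euclidean norm. -/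
def opNorm {n : Type*} [Fintype n] [DecidableEq n] (A : Matrix n n ℝ) : ℝ :=
  ‖Matrix.toEuclideanCLM (n := n) (𝕜 := ℝ) A‖

/-- The norm `‖W u‖₂` of the weighted data. -/
def dataNorm {N : ℕ} (u : (Fin d → ℝ) → ℝ) (w : (Fin d → ℝ) → ℝ)
    (x : Fin N → Fin d → ℝ) : ℝ :=
  √(∑ i, (rowWeight w x i * u (x i)) ^ 2)

/-- The norm `‖W (u - Ψ c)‖₂` of the weighted residual. -/
def InputModel.residNorm (I : InputModel d) {N : ℕ} (u : (Fin d → ℝ) → ℝ)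
    (B : Finset (Fin d → ℕ)) (w : (Fin d → ℝ) → ℝ) (x : Fin N → Fin d → ℝ) (c : B → ℝ) : ℝ :=
  √(∑ i, (rowWeight w x i * u (x i) - (I.design B w x).mulVec c i) ^ 2)

/-- Basis Pursuit Denoising: `c` minimizes `‖c‖₁` subject to
`‖W (u - Ψ c)‖₂ ≤ δ ‖W u‖₂`. -/
def InputModel.IsBPDN (I : InputModel d) {N : ℕ} (u : (Fin d → ℝ) → ℝ)
    (B : Finset (Fin d → ℕ)) (w : (Fin d → ℝ) → ℝ) (x : Fin N → Fin d → ℝ) (δ : ℝ)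
    (c : B → ℝ) : Prop :=
  I.residNorm u B w x c ≤ δ * dataNorm u w x ∧
    ∀ c' : B → ℝ, I.residNorm u B w x c' ≤ δ * dataNorm u w x → ∑ k, |c k| ≤ ∑ k, |c' k|

/-- The coherence `μ₂(s)`: the supremum over the domain and over the subsets `S` of `B` with at
most `s` elements of `∑ k ∈ S, |w ψ_k|²`. -/
def InputModel.coherence (I : InputModel d) (B : Finset (Fin d → ℕ)) (w : (Fin d → ℝ) → ℝ)
    (s : ℕ) : ENNReal :=
  ⨆ ξ ∈ I.domain, ⨆ S : Finset (Fin d → ℕ), ⨆ (_ : S ⊆ B ∧ S.card ≤ s),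
    ENNReal.ofReal (∑ k ∈ S, (w ξ * I.psi k ξ) ^ 2)

/-- What one iteration of a basis- and sample-adaptive method has at hand when it computes its
surrogate: the working basis, the total number of samples collected so far, the joint law of these
samples (which need not be independent or identically distributed), and the weight function. -/
structure Iterate (d : ℕ) where
  basis : Finset (Fin d → ℕ)
  numSamples : ℕ
  sampleLaw : Measure (Fin numSamples → Fin d → ℝ)
  isProb : IsProbabilityMeasure sampleLaw
  weight : (Fin d → ℝ) → ℝ
  measurable_weight : Measurable weight
  weight_pos : ∀ ξ, 0 < weight ξ

attribute [instance] Iterate.isProb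

/-- A sampling distribution on the domain with a weight for which independent samples satisfy
`𝔼 (Dᵀ D) = 1` in the basis `B`, with finite coherence. -/
structure Reference (I : InputModel d) (B : Finset (Fin d → ℕ)) where
  dist : Measure (Fin d → ℝ)
  isProb : IsProbabilityMeasure dist
  dist_domain : dist I.domainᶜ = 0
  weight : (Fin d → ℝ) → ℝ
  measurable_weight : Measurable weight
  weight_pos : ∀ ξ, 0 < weight ξ
  isotropic : ∀ k ∈ B, ∀ l ∈ B,
    ∫ ξ, weight ξ ^ 2 * I.psi k ξ * I.psi l ξ ∂dist = if k = l then 1 else 0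
  coherence_lt_top : I.coherence B weight B.card < ⊤

attribute [instance] Reference.isProb

/-- The coherence `μ⋆(|B|)` of the reference distribution. -/
def Reference.mu {I : InputModel d} {B : Finset (Fin d → ℕ)} (R : Reference I B) : ℝ :=
  (I.coherence B R.weight B.card).toReal

/-- Non-sparse coupling of the iterate to independent samples from the reference distribution:
a joint law of the two sample pools for which
`ℙ (‖Dᵀ D - D⋆ᵀ D⋆‖ > τ) ≤ β exp (- κ_τ N μ⋆(|B|)⁻¹ (log |B|)⁻¹)` at every threshold
`τ ∈ [t₀, t]`. -/
def NonSparseCoupled (I : InputModel d) (it : Iterate d) (R : Reference I it.basis)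
    (β : ℝ) (κ : ℝ → ℝ) (t₀ t : ℝ) : Prop :=
  ∃ π : Measure ((Fin it.numSamples → Fin d → ℝ) × (Fin it.numSamples → Fin d → ℝ)),
    π.map Prod.fst = it.sampleLaw ∧
    π.map Prod.snd = Measure.pi (fun _ => R.dist) ∧
    ∀ τ ∈ Set.Icc t₀ t,
      π.real {z | τ < opNorm (I.gram it.basis it.weight z.1 - I.gram it.basis R.weight z.2)} ≤
        β * Real.exp (-(κ τ * it.numSamples * R.mu⁻¹ * (Real.log it.basis.card)⁻¹))

end PolyChaos

end

/-! Gram concentration. For independent reference samples, `N • D⋆ᵀD⋆` is a sum of isotropic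
rank-one matrices `v vᵀ` with `v ⬝ᵥ v ≤ μ⋆`. The Golden–Thompson inequality lets one summand at a
time be split off from the trace exponential, and Markov's inequality gives a matrix Chernoff bound
with prefactor `2|B|` (`Matrix.measureReal_lt_opNorm_le`). Golden–Thompson itself follows from the
Lie–Trotter formula and a trace inequality for powers `2 ^ k`. The coupling carries the bound to the
actual samples by the triangle inequality, the threshold `t` being split at the midpoint of `[t₀,
t]`. The factor `(log |B|)⁻¹` in the exponent absorbs the prefactor `|B|`.

Approximation. The basis is a sublevel set of the weighted degree `∑ (j+1)² k_j`. The quadratic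
weights make `∑ exp (-σ * weightedDegree k)` bounded independently of `d`, which controls both the
cardinality of the basis and the coefficient tail.

Recovery. When the Gram matrix is within `t < 1` of the identity, `D` is bounded below. The best and
the computed coefficients both have residual at most `Λ` times the best error, so they are close,
and the computed error is at most a constant times the best one. The cutoff of the weighted degree
is taken large enough to pay for that constant. -/

section LieTrotter

/-! ### The Lie–Trotter product formula. -/

variable {𝔸 : Type*} [NormedRing 𝔸]

/-- Telescoping: the difference of powers is the sum of `x ^ i * (x - y) * y ^ j` over `i + j = m`.
It turns a one-step error `o(1/m)` into an `m`-step error `o(1)`. -/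
theorem norm_pow_succ_sub_pow_succ_le {x y : 𝔸} {K : ℝ} (hx : ‖x‖ ≤ K) (hy : ‖y‖ ≤ K) (m : ℕ) :
    ‖x ^ (m + 1) - y ^ (m + 1)‖ ≤ (m + 1) * K ^ m * ‖x - y‖ := by
  have hK : 0 ≤ K := (norm_nonneg x).trans hx
  induction m with
  | zero => simp
  | succ m ih =>
    have e : x ^ (m + 1 + 1) - y ^ (m + 1 + 1)
        = x ^ (m + 1) * (x - y) + (x ^ (m + 1) - y ^ (m + 1)) * y := by
      rw [pow_succ x (m + 1), pow_succ y (m + 1)]; noncomm_ring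
    rw [e]
    have h1 : ‖x ^ (m + 1) * (x - y)‖ ≤ K ^ (m + 1) * ‖x - y‖ :=
      (norm_mul_le _ _).trans (mul_le_mul_of_nonneg_right
        ((norm_pow_le' x m.succ_pos).trans (pow_le_pow_left₀ (norm_nonneg _) hx _)) (norm_nonneg _))
    have h2 : ‖(x ^ (m + 1) - y ^ (m + 1)) * y‖ ≤ (m + 1) * K ^ m * ‖x - y‖ * K :=
      (norm_mul_le _ _).trans (mul_le_mul ih hy (norm_nonneg _) (by positivity))
    refine (norm_add_le _ _).trans ((add_le_add h1 h2).trans (le_of_eq ?_))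
    push_cast; ring

variable [NormedAlgebra ℝ 𝔸] [NormOneClass 𝔸] [CompleteSpace 𝔸]

theorem norm_exp_le_exp_norm (x : 𝔸) : ‖NormedSpace.exp x‖ ≤ Real.exp ‖x‖ := by
  have h1 := NormedSpace.exp_series_hasSum_exp' (𝕂 := ℝ) x
  have h2 := NormedSpace.exp_series_hasSum_exp' (𝕂 := ℝ) ‖x‖
  rw [← Real.exp_eq_exp_ℝ] at h2
  refine h1.norm_le_of_bounded h2 fun n => ?_
  rw [norm_smul, smul_eq_mul, Real.norm_of_nonneg (by positivity)]
  exact mul_le_mul_of_nonneg_left (norm_pow_le x n) (by positivity)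

/-- The **Lie–Trotter product formula**. -/
theorem tendsto_exp_mul_exp_pow (a b : 𝔸) :
    Tendsto (fun m : ℕ => (NormedSpace.exp (((m : ℝ) + 1)⁻¹ • a) *
      NormedSpace.exp (((m : ℝ) + 1)⁻¹ • b)) ^ (m + 1)) atTop (𝓝 (NormedSpace.exp (a + b))) := by
  set f : ℝ → 𝔸 := fun t => NormedSpace.exp (t • a) * NormedSpace.exp (t • b) with hf
  set g : ℝ → 𝔸 := fun t => NormedSpace.exp (t • (a + b)) with hg
  -- `f` and `g` agree to first order at `0`, so `(m + 1) * ‖f r - g r‖` tends to `0` along `r = 1 /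
  -- (m + 1)`.
  have hd : HasDerivAt (fun t => f t - g t) 0 0 := by
    have h := ((hasDerivAt_exp_smul_const (𝕂 := ℝ) a 0).mul
      (hasDerivAt_exp_smul_const (𝕂 := ℝ) b 0)).sub (hasDerivAt_exp_smul_const (𝕂 := ℝ) (a + b) 0)
    exact h.congr_deriv (by simp)
  have ht : Tendsto (fun m : ℕ => ((m : ℝ) + 1)⁻¹) atTop (𝓝[≠] 0) := by
    rw [tendsto_nhdsWithin_iff]
    refine ⟨?_, Eventually.of_forall fun m => by simp; positivity⟩
    simpa [one_div] using tendsto_one_div_add_atTop_nhds_zero_nat (𝕜 := ℝ)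
  have hs := (hd.tendsto_slope_zero.comp ht).norm
  simp only [Function.comp_def, norm_zero, zero_add, inv_inv] at hs
  have h0 : f 0 - g 0 = 0 := by simp [f, g]
  simp only [h0, sub_zero] at hs
  have hgm : ∀ m : ℕ, g (((m : ℝ) + 1)⁻¹) ^ (m + 1) = NormedSpace.exp (a + b) := by
    intro m
    let _ : NormedAlgebra ℚ 𝔸 := NormedAlgebra.restrictScalars ℚ ℝ 𝔸
    rw [hg]; simp only
    rw [← NormedSpace.exp_nsmul, ← Nat.cast_smul_eq_nsmul ℝ, smul_smul]
    push_cast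
    rw [mul_inv_cancel₀ (by positivity), one_smul]
  rw [tendsto_iff_norm_sub_tendsto_zero]
  refine squeeze_zero (fun _ => norm_nonneg _) (fun m => ?_)
    (by simpa using hs.const_mul (Real.exp (‖a‖ + ‖b‖)))
  have hm : (0 : ℝ) < (m : ℝ) + 1 := by positivity
  set r : ℝ := ((m : ℝ) + 1)⁻¹ with hr
  have hr0 : 0 < r := by positivity
  have hfK : ‖f r‖ ≤ Real.exp (r * (‖a‖ + ‖b‖)) := by
    rw [mul_add, Real.exp_add]
    refine (norm_mul_le _ _).trans (mul_le_mul ?_ ?_ (norm_nonneg _) (Real.exp_nonneg _)) <;>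
    · refine (norm_exp_le_exp_norm _).trans (le_of_eq ?_)
      rw [norm_smul, Real.norm_of_nonneg hr0.le]
  have hgK : ‖g r‖ ≤ Real.exp (r * (‖a‖ + ‖b‖)) := by
    refine (norm_exp_le_exp_norm _).trans (Real.exp_le_exp.2 ?_)
    rw [norm_smul, Real.norm_of_nonneg hr0.le]
    exact mul_le_mul_of_nonneg_left (norm_add_le _ _) hr0.le
  have hK : Real.exp (r * (‖a‖ + ‖b‖)) ^ m ≤ Real.exp (‖a‖ + ‖b‖) := by
    rw [← Real.exp_nat_mul]
    refine Real.exp_le_exp.2 ?_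
    rw [← mul_assoc]
    refine mul_le_of_le_one_left (by positivity) ?_
    rw [hr, ← div_eq_mul_inv, div_le_one hm]; linarith
  rw [← hgm m]
  refine (norm_pow_succ_sub_pow_succ_le hfK hgK m).trans ?_
  rw [norm_smul, Real.norm_of_nonneg hm.le, mul_right_comm, mul_comm]
  exact mul_le_mul_of_nonneg_right hK (by positivity)

end LieTrotter

/-! ### The Golden–Thompson inequality. -/

namespace Matrix

variable {n : Type*} [Fintype n]

theorem trace_transpose_mul_self_nonneg (A : Matrix n n ℝ) : 0 ≤ (Aᵀ * A).trace := by
  simp only [trace, diag, mul_apply, transpose_apply]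
  exact Finset.sum_nonneg fun i _ => Finset.sum_nonneg fun j _ => mul_self_nonneg _

theorem two_mul_trace_transpose_mul_le (A B : Matrix n n ℝ) :
    2 * (Aᵀ * B).trace ≤ (Aᵀ * A).trace + (Bᵀ * B).trace := by
  have h := trace_transpose_mul_self_nonneg (A - B)
  have e : (Bᵀ * A).trace = (Aᵀ * B).trace := by
    rw [← trace_transpose, transpose_mul, transpose_transpose]
  simp only [transpose_sub, sub_mul, mul_sub, trace_sub] at h
  linarith

variable [DecidableEq n]

theorem trace_mul_pow_comm (A B : Matrix n n ℝ) (m : ℕ) :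
    ((A * B) ^ m).trace = ((B * A) ^ m).trace := by
  cases m with
  | zero => simp
  | succ m =>
    have h : ∀ k : ℕ, (A * B) ^ k * A = A * (B * A) ^ k := fun k => by
      induction k with
      | zero => simp
      | succ k ih => rw [pow_succ', mul_assoc, ih, pow_succ']; simp only [mul_assoc]
    rw [pow_succ, ← mul_assoc, h, trace_mul_comm, ← mul_assoc, pow_succ']

/-- The two claims feed each other. For the first, apply the previous case to `M ^ 2`, rotate the
trace to obtain a power of `(Mᵀ * M) * (M * Mᵀ)`, separate the factors by the second claim, and
finish with the arithmetic-geometric inequality for the trace pairing. For the second, apply the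
first to `P * Q` and rotate to `P ^ 2 * Q ^ 2`. -/
theorem trace_pow_two_pow_le (k : ℕ) :
    (∀ M : Matrix n n ℝ, (M ^ 2 ^ (k + 1)).trace ≤ ((Mᵀ * M) ^ 2 ^ k).trace) ∧
    ∀ P Q : Matrix n n ℝ, P.IsSymm → Q.IsSymm →
      ((P * Q) ^ 2 ^ k).trace ≤ (P ^ 2 ^ k * Q ^ 2 ^ k).trace := by
  induction k with
  | zero =>
    refine ⟨fun M => ?_, fun P Q _ _ => by simp⟩
    have h := two_mul_trace_transpose_mul_le Mᵀ M
    rw [transpose_transpose, trace_mul_comm M Mᵀ] at h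
    simp only [zero_add, pow_one, pow_zero, sq]
    linarith
  | succ k ih =>
    obtain ⟨hS, hR⟩ := ih
    refine ⟨fun M => ?_, fun P Q hP hQ => ?_⟩
    · have hP : (Mᵀ * M).IsSymm := isSymm_transpose_mul_self M
      have hQ : (M * Mᵀ).IsSymm := isSymm_mul_transpose_self M
      have h1 : (M ^ 2 ^ (k + 1 + 1)).trace ≤
          ((Mᵀ * M) ^ 2 ^ k * (M * Mᵀ) ^ 2 ^ k).trace := by
        rw [pow_succ' 2 (k + 1), pow_mul]
        refine (hS (M ^ 2)).trans ?_
        have e : (M ^ 2)ᵀ * M ^ 2 = Mᵀ * (Mᵀ * M * M) := by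
          rw [transpose_pow]; simp only [sq, mul_assoc]
        rw [e, trace_mul_pow_comm]
        have e' : Mᵀ * M * M * Mᵀ = (Mᵀ * M) * (M * Mᵀ) := by simp only [mul_assoc]
        rw [e']
        exact hR _ _ hP hQ
      have h2 := two_mul_trace_transpose_mul_le ((Mᵀ * M) ^ 2 ^ k) ((M * Mᵀ) ^ 2 ^ k)
      rw [transpose_pow, transpose_pow, hP.eq, hQ.eq, ← pow_add, ← pow_add, ← two_mul,
        ← pow_succ', trace_mul_pow_comm M Mᵀ] at h2
      linarith
    · rw [pow_succ', pow_mul P, pow_mul Q, ← pow_succ']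
      refine (hS (P * Q)).trans ?_
      have e : (P * Q)ᵀ * (P * Q) = Q * (P ^ 2 * Q) := by
        rw [transpose_mul, hP.eq, hQ.eq]; simp only [sq, mul_assoc]
      rw [e, trace_mul_pow_comm, mul_assoc, ← sq]
      exact hR _ _ (hP.pow 2) (hQ.pow 2)

/-- The **Golden–Thompson inequality** for real symmetric matrices. -/
theorem trace_exp_add_le {A B : Matrix n n ℝ} (hA : A.IsSymm) (hB : B.IsSymm) :
    (NormedSpace.exp (A + B)).trace ≤ (NormedSpace.exp A * NormedSpace.exp B).trace := by
  open scoped Matrix.Norms.L2Operator in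
  cases isEmpty_or_nonempty n
  · simp [trace]
  let _ : NormedAlgebra ℚ (Matrix n n ℝ) := NormedAlgebra.restrictScalars ℚ ℝ _
  -- Lie–Trotter is used along the exponents `m + 1 = 2 ^ k`, where the trace inequality applies to
  -- `exp (A / 2 ^ k)` and `exp (B / 2 ^ k)`.
  have h2 : Tendsto (fun k : ℕ => 2 ^ k - 1) atTop atTop :=
    (tendsto_sub_atTop_nat 1).comp (tendsto_pow_atTop_atTop_of_one_lt (by norm_num))
  have hlim := (continuous_id.matrix_trace.tendsto _).comp
    ((tendsto_exp_mul_exp_pow A B).comp h2)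
  refine le_of_tendsto hlim (Eventually.of_forall fun k => ?_)
  have hk : 2 ^ k - 1 + 1 = 2 ^ k := Nat.sub_add_cancel Nat.one_le_two_pow
  have hk' : ((2 ^ k - 1 : ℕ) : ℝ) + 1 = 2 ^ k := by exact_mod_cast hk
  simp only [Function.comp_apply, id, hk, hk']
  refine ((trace_pow_two_pow_le k).2 _ _ (hA.smul _).exp (hB.smul _).exp).trans (le_of_eq ?_)
  have e : ∀ X : Matrix n n ℝ, NormedSpace.exp (((2 : ℝ) ^ k)⁻¹ • X) ^ 2 ^ k
      = NormedSpace.exp X := fun X => by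
    rw [← NormedSpace.exp_nsmul, ← Nat.cast_smul_eq_nsmul ℝ, smul_smul]
    push_cast
    rw [mul_inv_cancel₀ (by positivity), one_smul]
  rw [e, e]

end Matrix

/-! ### Trace exponentials of sums of rank-one matrices. -/

namespace Matrix

variable {n : Type*} [Fintype n]

/-- By convexity, the chord slope of `s ↦ exp (θ * s)` from `0` increases with `s`, whatever the
sign of `θ`. -/
theorem exp_mul_sub_one_div_le {s μ : ℝ} (hs : 0 < s) (hsμ : s ≤ μ) (θ : ℝ) :
    (Real.exp (θ * s) - 1) / s ≤ (Real.exp (θ * μ) - 1) / μ := by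
  have hμ : 0 < μ := hs.trans_le hsμ
  have h := convexOn_exp.2 (Set.mem_univ (θ * μ)) (Set.mem_univ 0) (div_nonneg hs.le hμ.le)
    (sub_nonneg.2 ((div_le_one hμ).2 hsμ)) (by ring)
  have e : (s / μ) • (θ * μ) + (1 - s / μ) • (0 : ℝ) = θ * s := by
    simp only [smul_eq_mul]; field_simp; ring
  rw [e, Real.exp_zero] at h
  simp only [smul_eq_mul] at h
  rw [div_le_iff₀ hs]
  have e2 : (Real.exp (θ * μ) - 1) / μ * s = s / μ * Real.exp (θ * μ) + (1 - s / μ) * 1 - 1 := by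
    ring
  rw [e2]; linarith

theorem isSymm_vecMulVec_self {n : Type*} (v : n → ℝ) : (vecMulVec v v).IsSymm := by
  ext i j; simp [vecMulVec_apply, mul_comm]

theorem vecMulVec_mul_vecMulVec_self (v : n → ℝ) :
    vecMulVec v v * vecMulVec v v = (v ⬝ᵥ v) • vecMulVec v v := by
  ext i j
  simp only [mul_apply, vecMulVec_apply, smul_apply, dotProduct, smul_eq_mul, Finset.sum_mul]
  exact Finset.sum_congr rfl fun k _ => by ring

theorem trace_mul_vecMulVec (E : Matrix n n ℝ) (v w : n → ℝ) :
    (E * vecMulVec v w).trace = w ⬝ᵥ E *ᵥ v := by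
  simp only [trace, diag, mul_apply, vecMulVec_apply, dotProduct, mulVec, Finset.mul_sum]
  exact Finset.sum_congr rfl fun i _ => Finset.sum_congr rfl fun k _ => by ring

variable [DecidableEq n]

/-- `P = v vᵀ / (v ⬝ᵥ v)` is idempotent, so `exp (x • P) = (1 - P) + exp x • P`. -/
theorem exp_smul_vecMulVec_self {v : n → ℝ} (hv : v ⬝ᵥ v ≠ 0) (θ : ℝ) :
    NormedSpace.exp (θ • vecMulVec v v) =
      1 + ((Real.exp (θ * (v ⬝ᵥ v)) - 1) / (v ⬝ᵥ v)) • vecMulVec v v := by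
  open scoped Matrix.Norms.L2Operator in
  set s := v ⬝ᵥ v with hs
  set P : Matrix n n ℝ := s⁻¹ • vecMulVec v v with hP
  have hPP : P * P = P := by
    rw [hP, smul_mul_smul_comm, vecMulVec_mul_vecMulVec_self, smul_smul, ← hs]
    congr 1; field_simp
  have hQ : θ • vecMulVec v v = (θ * s) • P := by
    rw [hP, smul_smul]; congr 1; field_simp
  have hpow : ∀ m : ℕ, P ^ m = (if m = 0 then 1 - P else 0) + P := fun m => by
    rcases Nat.eq_zero_or_pos m with rfl | hm
    · simp
    · rw [if_neg hm.ne', zero_add]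
      exact IsIdempotentElem.pow_eq hPP hm.ne'
  have h1 := NormedSpace.exp_series_hasSum_exp' (𝕂 := ℝ) ((θ * s) • P)
  have h2 := NormedSpace.exp_series_hasSum_exp' (𝕂 := ℝ) (θ * s)
  rw [← Real.exp_eq_exp_ℝ] at h2
  have h3 : HasSum (fun m : ℕ => ((m.factorial : ℝ)⁻¹ • ((θ * s) • P) ^ m))
      ((1 - P) + Real.exp (θ * s) • P) := by
    have h4 : HasSum (fun m : ℕ => if m = 0 then 1 - P else 0) (1 - P) := hasSum_ite_eq 0 _
    refine (h4.add (h2.smul_const P)).congr_fun ?_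
    intro m
    rcases Nat.eq_zero_or_pos m with rfl | hm
    · simp
    · rw [smul_pow, hpow m, if_neg hm.ne', zero_add, zero_add, smul_smul, smul_eq_mul]
  rw [hQ, h1.unique h3, hP, smul_smul, div_eq_mul_inv, sub_mul, one_mul, sub_smul]
  abel

/-- `exp A` is the square of the symmetric matrix `exp (A / 2)`. -/
theorem dotProduct_exp_mulVec_nonneg {A : Matrix n n ℝ} (hA : A.IsSymm) (v : n → ℝ) :
    0 ≤ v ⬝ᵥ NormedSpace.exp A *ᵥ v := by
  set X := NormedSpace.exp ((2 : ℝ)⁻¹ • A) with hX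
  have hXs : X.IsSymm := (hA.smul _).exp
  have e : NormedSpace.exp A = X * X := by
    rw [hX, ← Matrix.exp_add_of_commute _ _ (Commute.refl _), ← add_smul]
    norm_num
  rw [e, ← mulVec_mulVec, dotProduct_mulVec, ← mulVec_transpose, hXs.eq]
  exact Finset.sum_nonneg fun i _ => mul_self_nonneg _

theorem trace_exp_nonneg {A : Matrix n n ℝ} (hA : A.IsSymm) : 0 ≤ (NormedSpace.exp A).trace := by
  refine Finset.sum_nonneg fun i _ => ?_
  have h := dotProduct_exp_mulVec_nonneg hA (Pi.single i 1)
  simpa using h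

/-- Golden–Thompson separates the rank-one term, whose exponential is explicit. The resulting bound
is linear in the quadratic form of `v`, so its expectation needs only isotropy. -/
theorem trace_exp_add_smul_vecMulVec_le {A : Matrix n n ℝ} (hA : A.IsSymm) {v : n → ℝ} {μ : ℝ}
    (hv : v ⬝ᵥ v ≤ μ) (θ : ℝ) :
    (NormedSpace.exp (A + θ • vecMulVec v v)).trace ≤ (NormedSpace.exp A).trace +
      (Real.exp (θ * μ) - 1) / μ * (v ⬝ᵥ NormedSpace.exp A *ᵥ v) := by
  by_cases h0 : v ⬝ᵥ v = 0
  · have : v = 0 := dotProduct_self_eq_zero.1 h0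
    simp [this]
  have hpos : 0 < v ⬝ᵥ v :=
    lt_of_le_of_ne (Finset.sum_nonneg fun i _ => mul_self_nonneg _) (Ne.symm h0)
  refine (trace_exp_add_le hA ((isSymm_vecMulVec_self v).smul θ)).trans ?_
  rw [exp_smul_vecMulVec_self h0, mul_add, mul_one, trace_add, mul_smul_comm, trace_smul,
    trace_mul_vecMulVec, smul_eq_mul]
  exact add_le_add le_rfl (mul_le_mul_of_nonneg_right (exp_mul_sub_one_div_le hpos hv θ)
    (dotProduct_exp_mulVec_nonneg hA v))

section

variable {n Ω : Type*} [Fintype n] [MeasurableSpace Ω] {ν : Measure Ω} {a : Ω → n → ℝ}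

theorem integrable_mul_of_dotProduct_self_le [IsFiniteMeasure ν] (ha : Measurable a) {μ : ℝ}
    (hb : ∀ᵐ ω ∂ν, a ω ⬝ᵥ a ω ≤ μ) (k l : n) : Integrable (fun ω => a ω k * a ω l) ν := by
  refine Integrable.of_bound (((measurable_pi_apply k).comp ha).mul
    ((measurable_pi_apply l).comp ha)).aestronglyMeasurable μ (hb.mono fun ω h => ?_)
  have h1 : ∀ j, a ω j * a ω j ≤ μ := fun j =>
    (Finset.single_le_sum (f := fun j => a ω j * a ω j) (fun i _ => mul_self_nonneg _)
      (Finset.mem_univ j)).trans h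
  rw [Real.norm_eq_abs, abs_le]
  constructor <;> nlinarith [h1 k, h1 l, sq_nonneg (a ω k + a ω l), sq_nonneg (a ω k - a ω l)]

theorem integral_dotProduct_mulVec [DecidableEq n] (hint : ∀ k l, Integrable (fun ω => a ω k * a ω l) ν)
    (hiso : ∀ k l, ∫ ω, a ω k * a ω l ∂ν = if k = l then 1 else 0) (E : Matrix n n ℝ) :
    Integrable (fun ω => a ω ⬝ᵥ E *ᵥ a ω) ν ∧ ∫ ω, a ω ⬝ᵥ E *ᵥ a ω ∂ν = E.trace := by
  have e : (fun ω => a ω ⬝ᵥ E *ᵥ a ω) = fun ω => ∑ k, ∑ l, E k l * (a ω k * a ω l) := by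
    ext ω
    simp only [dotProduct, mulVec, Finset.mul_sum]
    exact Finset.sum_congr rfl fun i _ => Finset.sum_congr rfl fun k _ => by ring
  rw [e]
  refine ⟨integrable_finsetSum _ fun k _ => integrable_finsetSum _ fun l _ =>
    (hint k l).const_mul _, ?_⟩
  refine (integral_finsetSum _ fun k _ => integrable_finsetSum _ fun l _ =>
    (hint k l).const_mul _).trans (Finset.sum_congr rfl fun k _ => ?_)
  refine (integral_finsetSum _ fun l _ => (hint k l).const_mul _).trans ?_
  simp [integral_const_mul, hiso]

end

section Chernoff

variable {Ω : Type*} [MeasurableSpace Ω] {ν : Measure Ω} [IsProbabilityMeasure ν] {a : Ω → n → ℝ}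

/-- The rank-one sum `∑ i, a (x i) (a (x i))ᵀ`. -/
noncomputable def sumVecMulVec {N : ℕ} (a : Ω → n → ℝ) (x : Fin N → Ω) : Matrix n n ℝ :=
  ∑ i, vecMulVec (a (x i)) (a (x i))

theorem measurable_trace_exp_add_smul_sumVecMulVec (ha : Measurable a) (θ : ℝ) (N : ℕ)
    (A : Matrix n n ℝ) :
    Measurable fun p : (n → ℝ) × (Fin N → Ω) =>
      (NormedSpace.exp (A + θ • vecMulVec p.1 p.1 + θ • sumVecMulVec a p.2)).trace := by
  have hexp : Continuous (NormedSpace.exp : Matrix n n ℝ → Matrix n n ℝ) := by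
    open scoped Matrix.Norms.L2Operator in
    let _ : NormedAlgebra ℚ (Matrix n n ℝ) := NormedAlgebra.restrictScalars ℚ ℝ _
    exact NormedSpace.exp_continuous
  have hc : Continuous fun q : (n → ℝ) × (Fin N → n → ℝ) =>
      (NormedSpace.exp (A + θ • vecMulVec q.1 q.1 +
        θ • ∑ i, vecMulVec (q.2 i) (q.2 i))).trace := by
    refine Continuous.matrix_trace (hexp.comp ?_)
    refine (continuous_const.add ?_).add ?_
    · exact (continuous_fst.matrix_vecMulVec continuous_fst).const_smul θ
    · refine (continuous_finsetSum _ fun i _ => ?_).const_smul θ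
      have : Continuous fun q : (n → ℝ) × (Fin N → n → ℝ) => q.2 i :=
        (continuous_apply i).comp continuous_snd
      exact this.matrix_vecMulVec this
  have hm : Measurable fun p : (n → ℝ) × (Fin N → Ω) => (p.1, fun i => a (p.2 i)) :=
    measurable_fst.prodMk (measurable_pi_lambda _ fun i =>
      ha.comp ((measurable_pi_apply i).comp measurable_snd))
  have h := hc.measurable.comp hm
  simp only [Function.comp_def] at h
  simpa only [sumVecMulVec] using h

/-- The matrix Laplace transform bound for sums of independent isotropic rank-one matrices. -/
theorem lintegral_trace_exp_le (ha : Measurable a)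
    (hiso : ∀ k l, ∫ ω, a ω k * a ω l ∂ν = if k = l then 1 else 0) {μ : ℝ}
    (hb : ∀ᵐ ω ∂ν, a ω ⬝ᵥ a ω ≤ μ) (θ : ℝ) (N : ℕ) {A : Matrix n n ℝ} (hA : A.IsSymm) :
    ∫⁻ x, ENNReal.ofReal (NormedSpace.exp (A + θ • sumVecMulVec a x)).trace
        ∂(Measure.pi fun _ : Fin N => ν) ≤
      ENNReal.ofReal ((NormedSpace.exp A).trace *
        Real.exp (N * ((Real.exp (θ * μ) - 1) / μ))) := by
  set g := (Real.exp (θ * μ) - 1) / μ with hg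
  -- The first sample is absorbed into `A` before the hypothesis for the other `N` is used.
  -- Averaging over it then costs a factor `1 + g ≤ exp g`, because isotropy turns the quadratic
  -- form into a trace.
  induction N generalizing A with
  | zero => simp [sumVecMulVec]
  | succ N ih =>
    set F : Ω × (Fin N → Ω) → ENNReal := fun p => ENNReal.ofReal
      (NormedSpace.exp (A + θ • vecMulVec (a p.1) (a p.1) + θ • sumVecMulVec a p.2)).trace with hF
    have hFm : Measurable F :=
      ((measurable_trace_exp_add_smul_sumVecMulVec ha θ N A).comp
        ((ha.comp measurable_fst).prodMk measurable_snd)).ennreal_ofReal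
    have h1 := (measurePreserving_piFinSuccAbove (fun _ : Fin (N + 1) => ν) 0).lintegral_comp hFm
    have e : (fun x : Fin (N + 1) → Ω =>
        ENNReal.ofReal (NormedSpace.exp (A + θ • sumVecMulVec a x)).trace) =
        fun x => F (MeasurableEquiv.piFinSuccAbove (fun _ => Ω) 0 x) := by
      ext x
      simp only [hF, sumVecMulVec, Fin.sum_univ_succ, smul_add, add_assoc]
      rfl
    rw [e, h1, lintegral_prod _ hFm.aemeasurable]
    obtain ⟨hI, hE⟩ := integral_dotProduct_mulVec
      (integrable_mul_of_dotProduct_self_le ha hb) hiso (NormedSpace.exp A)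
    calc ∫⁻ ω, ∫⁻ x, F (ω, x) ∂(Measure.pi fun _ : Fin N => ν) ∂ν
        ≤ ∫⁻ ω, ENNReal.ofReal (((NormedSpace.exp A).trace +
            g * (a ω ⬝ᵥ NormedSpace.exp A *ᵥ a ω)) * Real.exp (N * g)) ∂ν := by
          refine lintegral_mono_ae (hb.mono fun ω hω => ?_)
          have h3 := ih (hA.add ((isSymm_vecMulVec_self (a ω)).smul θ))
          simp only [hF]
          refine h3.trans (ENNReal.ofReal_le_ofReal ?_)
          exact mul_le_mul_of_nonneg_right (trace_exp_add_smul_vecMulVec_le hA hω θ)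
            (Real.exp_nonneg _)
      _ = ENNReal.ofReal (((NormedSpace.exp A).trace + g * (NormedSpace.exp A).trace) *
            Real.exp (N * g)) := by
          rw [← ofReal_integral_eq_lintegral_ofReal, integral_mul_const,
            integral_add (integrable_const _) (hI.const_mul _), integral_const_mul, hE]
          · simp
          · exact ((integrable_const _).add (hI.const_mul _)).mul_const _
          · refine hb.mono fun ω hω => mul_nonneg ?_ (Real.exp_nonneg _)
            exact (trace_exp_nonneg (hA.add ((isSymm_vecMulVec_self _).smul _))).trans
              (trace_exp_add_smul_vecMulVec_le hA hω θ)
      _ ≤ _ := by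
          refine ENNReal.ofReal_le_ofReal ?_
          have h2 : (NormedSpace.exp A).trace + g * (NormedSpace.exp A).trace ≤
              (NormedSpace.exp A).trace * Real.exp g := by
            have := mul_le_mul_of_nonneg_left (Real.add_one_le_exp g) (trace_exp_nonneg hA)
            linarith
          refine (mul_le_mul_of_nonneg_right h2 (Real.exp_nonneg _)).trans (le_of_eq ?_)
          rw [mul_assoc, ← Real.exp_add]
          push_cast; ring_nf

end Chernoff

theorem IsHermitian.trace_exp_smul {A : Matrix n n ℝ} (hA : A.IsHermitian) (c : ℝ) :
    (NormedSpace.exp (c • A)).trace = ∑ i, Real.exp (c * hA.eigenvalues i) := by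
  set U := Unitary.toUnits hA.eigenvectorUnitary with hU
  have h : A = (U : Matrix n n ℝ) * diagonal hA.eigenvalues * ((U⁻¹ : (Matrix n n ℝ)ˣ) : Matrix n n ℝ) := by
    conv_lhs => rw [hA.spectral_theorem]
    rfl
  have h2 : c • A = (U : Matrix n n ℝ) * diagonal (c • hA.eigenvalues) * ((U⁻¹ : (Matrix n n ℝ)ˣ) : Matrix n n ℝ) := by
    conv_lhs => rw [h]
    rw [diagonal_smul, mul_smul_comm, smul_mul_assoc]
  rw [h2, Matrix.exp_units_conj, trace_mul_comm, ← mul_assoc, Units.inv_mul, one_mul,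
    Matrix.exp_diagonal, trace_diagonal]
  refine Finset.sum_congr rfl fun i _ => ?_
  rw [Pi.coe_exp, Real.exp_eq_exp_ℝ]
  rfl

open scoped Matrix.Norms.L2Operator in
theorem IsHermitian.exists_lt_abs_eigenvalues_sub_one {A : Matrix n n ℝ} (hA : A.IsHermitian)
    {s : ℝ} (hs : 0 ≤ s) (h : s < PolyChaos.opNorm (A - 1)) :
    ∃ i, s < |hA.eigenvalues i - 1| := by
  by_contra! hc
  refine absurd h (not_lt.2 ?_)
  have e : A - 1 = (hA.eigenvectorUnitary : Matrix n n ℝ) * diagonal (hA.eigenvalues - 1) *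
      ((star hA.eigenvectorUnitary : unitaryGroup n ℝ) : Matrix n n ℝ) := by
    have h1 : A = (hA.eigenvectorUnitary : Matrix n n ℝ) * diagonal hA.eigenvalues *
        ((star hA.eigenvectorUnitary : unitaryGroup n ℝ) : Matrix n n ℝ) := by
      conv_lhs => rw [hA.spectral_theorem]
      rfl
    have h2 : diagonal (hA.eigenvalues - 1) = diagonal hA.eigenvalues - (1 : Matrix n n ℝ) := by
      rw [← diagonal_one, diagonal_sub]; rfl
    rw [h2, mul_sub, sub_mul, ← h1, mul_one]
    simp
  rw [PolyChaos.opNorm, ← cstar_norm_def, e, CStarRing.norm_mul_coe_unitary,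
    CStarRing.norm_coe_unitary_mul, l2_opNorm_diagonal]
  exact (pi_norm_le_iff_of_nonneg hs).2 fun i => hc i

/-- Some eigenvalue lies outside `[1 - s, 1 + s]`. Its own exponential is one of the positive terms
of the trace, with sign `c` for an eigenvalue too large and `-c` for one too small. -/
theorem IsHermitian.exp_le_trace_exp_of_lt_opNorm {A : Matrix n n ℝ} (hA : A.IsHermitian)
    {s : ℝ} (hs : 0 ≤ s) (h : s < PolyChaos.opNorm (A - 1)) {c : ℝ} (hc : 0 ≤ c) :
    Real.exp (c * (1 + s)) ≤ (NormedSpace.exp (c • A)).trace ∨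
      Real.exp (-c * (1 - s)) ≤ (NormedSpace.exp (-c • A)).trace := by
  obtain ⟨i, hi⟩ := hA.exists_lt_abs_eigenvalues_sub_one hs h
  rw [hA.trace_exp_smul, hA.trace_exp_smul]
  rcases lt_abs.1 hi with h1 | h1
  · left
    refine le_trans (Real.exp_le_exp.2 (mul_le_mul_of_nonneg_left ?_ hc))
      (Finset.single_le_sum (f := fun i => Real.exp (c * hA.eigenvalues i))
        (fun _ _ => Real.exp_nonneg _) (Finset.mem_univ i))
    linarith
  · right
    refine le_trans (Real.exp_le_exp.2 ?_)
      (Finset.single_le_sum (f := fun i => Real.exp (-c * hA.eigenvalues i))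
        (fun _ _ => Real.exp_nonneg _) (Finset.mem_univ i))
    nlinarith

end Matrix

/-! ### The matrix Chernoff bound. -/

namespace Matrix

variable {n : Type*} [Fintype n] [DecidableEq n] {Ω : Type*} [MeasurableSpace Ω] {ν : Measure Ω}
  [IsProbabilityMeasure ν] {a : Ω → n → ℝ}

theorem isSymm_sumVecMulVec {n Ω : Type*} {N : ℕ} (a : Ω → n → ℝ) (x : Fin N → Ω) :
    (sumVecMulVec a x).IsSymm := by
  ext i j
  simp [sumVecMulVec, sum_apply, vecMulVec_apply, mul_comm]

/-- Markov's inequality for the Laplace transform bound at `A = 0`, where `exp 0` has trace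
`Fintype.card n`. -/
theorem measureReal_exp_le_trace_exp_le (ha : Measurable a)
    (hiso : ∀ k l, ∫ ω, a ω k * a ω l ∂ν = if k = l then 1 else 0) {μ : ℝ}
    (hb : ∀ᵐ ω ∂ν, a ω ⬝ᵥ a ω ≤ μ) (θ b : ℝ) (N : ℕ) :
    (Measure.pi fun _ : Fin N => ν).real
        {x | Real.exp b ≤ (NormedSpace.exp (θ • sumVecMulVec a x)).trace} ≤
      Fintype.card n * Real.exp (N * ((Real.exp (θ * μ) - 1) / μ) - b) := by
  have hm : Measurable fun x : Fin N → Ω =>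
      ENNReal.ofReal (NormedSpace.exp (θ • sumVecMulVec a x)).trace := by
    have h := (measurable_trace_exp_add_smul_sumVecMulVec ha θ N (0 : Matrix n n ℝ)).comp
      (measurable_prodMk_left (x := (0 : n → ℝ)))
    simpa [Function.comp_def] using h.ennreal_ofReal
  have h1 := mul_meas_ge_le_lintegral₀ (μ := Measure.pi fun _ : Fin N => ν) hm.aemeasurable
    (ENNReal.ofReal (Real.exp b))
  have h2 := lintegral_trace_exp_le ha hiso hb θ N (A := 0) isSymm_zero
  simp only [zero_add] at h2
  have h3 := ENNReal.toReal_mono ENNReal.ofReal_ne_top (h1.trans h2)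
  have hset : {x : Fin N → Ω | ENNReal.ofReal (Real.exp b) ≤
      ENNReal.ofReal (NormedSpace.exp (θ • sumVecMulVec a x)).trace} =
      {x | Real.exp b ≤ (NormedSpace.exp (θ • sumVecMulVec a x)).trace} := by
    ext x
    exact ENNReal.ofReal_le_ofReal_iff (trace_exp_nonneg ((isSymm_sumVecMulVec a x).smul θ))
  rw [hset, ENNReal.toReal_mul, ENNReal.toReal_ofReal (Real.exp_nonneg _),
    ENNReal.toReal_ofReal (mul_nonneg (trace_exp_nonneg isSymm_zero) (Real.exp_nonneg _)),
    NormedSpace.exp_zero, trace_one, mul_comm] at h3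
  rw [Real.exp_sub, ← mul_div_assoc, le_div_iff₀ (Real.exp_pos _)]
  exact h3

/-- A **matrix Chernoff bound** for the empirical second moment of independent isotropic vectors
of bounded length. -/
theorem measureReal_lt_opNorm_le (ha : Measurable a)
    (hiso : ∀ k l, ∫ ω, a ω k * a ω l ∂ν = if k = l then 1 else 0) {μ : ℝ} (hμ : 0 < μ)
    (hb : ∀ᵐ ω ∂ν, a ω ⬝ᵥ a ω ≤ μ) {N : ℕ} (hN : 0 < N) {s : ℝ} (hs : 0 < s) (hs1 : s ≤ 1) :
    (Measure.pi fun _ : Fin N => ν).real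
        {x | s < PolyChaos.opNorm ((N : ℝ)⁻¹ • sumVecMulVec a x - 1)} ≤
      2 * Fintype.card n * Real.exp (-(s ^ 2 / 4 * (N / μ))) := by
  have hN' : (0 : ℝ) < N := Nat.cast_pos.2 hN
  -- This corresponds to `θ = ± s / (2 μ)` for the unnormalized sum. With `y = θ * μ`, the estimate
  -- `exp y - 1 - y ≤ y ^ 2` leaves the exponent `(N / μ) * (s² / 4 - s² / 2) = -(s² / 4) * (N /
  -- μ)`.
  set c : ℝ := s / 2 * N / μ with hc
  have hc0 : 0 ≤ c := by positivity
  have hsub : {x : Fin N → Ω | s < PolyChaos.opNorm ((N : ℝ)⁻¹ • sumVecMulVec a x - 1)} ⊆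
      {x | Real.exp (c * (1 + s)) ≤ (NormedSpace.exp ((s / 2 / μ) • sumVecMulVec a x)).trace} ∪
      {x | Real.exp (-c * (1 - s)) ≤
        (NormedSpace.exp ((-(s / 2 / μ)) • sumVecMulVec a x)).trace} := by
    intro x hx
    have hH : ((N : ℝ)⁻¹ • sumVecMulVec a x).IsHermitian := by
      rw [IsHermitian, conjTranspose_eq_transpose_of_trivial]
      exact (isSymm_sumVecMulVec a x).smul _
    have h := hH.exp_le_trace_exp_of_lt_opNorm hs.le hx hc0
    have e : c * (N : ℝ)⁻¹ = s / 2 / μ := by rw [hc]; field_simp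
    rw [smul_smul, smul_smul, neg_mul c (N : ℝ)⁻¹, e] at h
    exact h
  have hexp : ∀ y : ℝ, |y| = s / 2 → Real.exp y - 1 - y ≤ (s / 2) ^ 2 := fun y hy => by
    have h1 := Real.abs_exp_sub_one_sub_id_le (x := y) (by rw [hy]; linarith)
    rw [← hy, sq_abs]
    exact (le_abs_self _).trans h1
  refine (measureReal_mono hsub).trans ((measureReal_union_le _ _).trans ?_)
  have key : ∀ y b : ℝ, |y| = s / 2 → b = N / μ * (y + s ^ 2 / 2) →
      (Measure.pi fun _ : Fin N => ν).real
        {x | Real.exp b ≤ (NormedSpace.exp ((y / μ) • sumVecMulVec a x)).trace} ≤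
      Fintype.card n * Real.exp (-(s ^ 2 / 4 * (N / μ))) := by
    intro y b hy hb'
    refine (measureReal_exp_le_trace_exp_le ha hiso hb _ _ N).trans
      (mul_le_mul_of_nonneg_left (Real.exp_le_exp.2 ?_) (Nat.cast_nonneg _))
    rw [div_mul_cancel₀ _ hμ.ne', hb']
    have e : (N : ℝ) * ((Real.exp y - 1) / μ) - N / μ * (y + s ^ 2 / 2) =
        N / μ * (Real.exp y - 1 - y - s ^ 2 / 2) := by ring
    have e2 : -(s ^ 2 / 4 * (N / μ)) = N / μ * (-(s ^ 2 / 4)) := by ring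
    rw [e, e2]
    exact mul_le_mul_of_nonneg_left (by linarith [hexp y hy]) (by positivity)
  have h1 := key (s / 2) (c * (1 + s)) (abs_of_pos (by positivity)) (by rw [hc]; ring)
  have h2 := key (-(s / 2)) (-c * (1 - s)) (by rw [abs_neg, abs_of_pos (by positivity)])
    (by rw [hc]; ring)
  rw [neg_div] at h2
  linarith

end Matrix

/-! ### Concentration of Gram matrices and transfer through the coupling. -/

namespace PolyChaos

variable {d : ℕ}

theorem InputModel.continuous_psi (I : InputModel d) (k : Fin d → ℕ) : Continuous (I.psi k) :=
  continuous_finsetProd _ fun i _ => (I.poly i (k i)).continuous.comp (continuous_apply i)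

/-- The weighted basis vector `(w ψ_k)_{k ∈ B}`, a row of the design matrix up to scaling. -/
def weightedRow (I : InputModel d) (B : Finset (Fin d → ℕ)) (w : (Fin d → ℝ) → ℝ)
    (ξ : Fin d → ℝ) : B → ℝ :=
  fun k => w ξ * I.psi k ξ

theorem measurable_weightedRow (I : InputModel d) (B : Finset (Fin d → ℕ))
    {w : (Fin d → ℝ) → ℝ} (hw : Measurable w) : Measurable (weightedRow I B w) :=
  measurable_pi_lambda _ fun k => hw.mul (I.continuous_psi k).measurable

theorem InputModel.gram_eq (I : InputModel d) (B : Finset (Fin d → ℕ)) (w : (Fin d → ℝ) → ℝ)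
    {N : ℕ} (x : Fin N → Fin d → ℝ) :
    I.gram B w x = (N : ℝ)⁻¹ • Matrix.sumVecMulVec (weightedRow I B w) x := by
  ext k l
  have h : (√(N : ℝ))⁻¹ * (√(N : ℝ))⁻¹ = (N : ℝ)⁻¹ := by
    rw [← mul_inv, Real.mul_self_sqrt (Nat.cast_nonneg _)]
  simp only [InputModel.gram, InputModel.design, Matrix.mul_apply, Matrix.transpose_apply,
    Matrix.of_apply, Matrix.smul_apply, Matrix.sumVecMulVec, Matrix.sum_apply,
    Matrix.vecMulVec_apply, weightedRow, rowWeight, smul_eq_mul, Finset.mul_sum, ← h]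
  exact Finset.sum_congr rfl fun i _ => by ring

namespace Reference

variable {I : InputModel d} {B : Finset (Fin d → ℕ)} (R : Reference I B)

theorem integral_weightedRow_mul (k l : B) :
    ∫ ξ, weightedRow I B R.weight ξ k * weightedRow I B R.weight ξ l ∂(R.dist) =
      if k = l then 1 else 0 := by
  have h := R.isotropic k k.2 l l.2
  simp only [Subtype.ext_iff]
  rw [← h]
  exact integral_congr_ae (Eventually.of_forall fun ξ => by simp only [weightedRow]; ring)

theorem weightedRow_dotProduct_self_le :
    ∀ᵐ ξ ∂(R.dist), weightedRow I B R.weight ξ ⬝ᵥ weightedRow I B R.weight ξ ≤ R.mu := by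
  have hdom : ∀ᵐ ξ ∂(R.dist), ξ ∈ I.domain := R.dist_domain
  refine hdom.mono fun ξ hξ => ?_
  have h1 : ENNReal.ofReal (∑ k ∈ B, (R.weight ξ * I.psi k ξ) ^ 2) ≤
      I.coherence B R.weight B.card :=
    le_iSup₂_of_le ξ hξ (le_iSup₂_of_le B ⟨subset_rfl, le_rfl⟩ le_rfl)
  have h2 := (ENNReal.ofReal_le_iff_le_toReal R.coherence_lt_top.ne).1 h1
  refine le_of_eq_of_le ?_ h2
  rw [← Finset.sum_coe_sort]
  exact Finset.sum_congr rfl fun k _ => by simp only [weightedRow]; ring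

/-- A single normalized function already has mean square `1`, and its square is at most `R.mu`
almost everywhere. -/
theorem one_le_mu (hB : B.Nonempty) : 1 ≤ R.mu := by
  obtain ⟨k, hk⟩ := hB
  have h := R.integral_weightedRow_mul ⟨k, hk⟩ ⟨k, hk⟩
  rw [if_pos rfl] at h
  have hm : ∫ ξ, weightedRow I B R.weight ξ ⟨k, hk⟩ * weightedRow I B R.weight ξ ⟨k, hk⟩ ∂(R.dist) ≤
      ∫ _, R.mu ∂(R.dist) := by
    refine integral_mono_ae (Matrix.integrable_mul_of_dotProduct_self_le
      (measurable_weightedRow I B R.measurable_weight) R.weightedRow_dotProduct_self_le _ _)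
      (integrable_const _) (R.weightedRow_dotProduct_self_le.mono fun ξ hξ => ?_)
    exact (Finset.single_le_sum (f := fun j => weightedRow I B R.weight ξ j *
      weightedRow I B R.weight ξ j) (fun i _ => mul_self_nonneg _) (Finset.mem_univ _)).trans hξ
  simpa [h] using hm

/-- Concentration of the Gram matrix of independent samples from the reference distribution. -/
theorem measureReal_lt_opNorm_gram_sub_one_le (hB : B.Nonempty) {N : ℕ} (hN : 0 < N) {s : ℝ}
    (hs : 0 < s) (hs1 : s ≤ 1) :
    (Measure.pi fun _ : Fin N => R.dist).real {x | s < opNorm (I.gram B R.weight x - 1)} ≤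
      2 * B.card * Real.exp (-(s ^ 2 / 4 * (N / R.mu))) := by
  have h := Matrix.measureReal_lt_opNorm_le (measurable_weightedRow I B R.measurable_weight)
    R.integral_weightedRow_mul (zero_lt_one.trans_le (R.one_le_mu hB))
    R.weightedRow_dotProduct_self_le hN hs hs1
  simpa only [InputModel.gram_eq, Fintype.card_coe] using h

end Reference

theorem continuous_opNorm {n : Type*} [Fintype n] [DecidableEq n] :
    Continuous (opNorm : Matrix n n ℝ → ℝ) := by
  open scoped Matrix.Norms.L2Operator in
  exact continuous_norm

theorem opNorm_add_le {n : Type*} [Fintype n] [DecidableEq n] (A B : Matrix n n ℝ) :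
    opNorm (A + B) ≤ opNorm A + opNorm B := by
  rw [opNorm, map_add]
  exact norm_add_le _ _

theorem measurable_opNorm_gram_sub_one (I : InputModel d) (B : Finset (Fin d → ℕ))
    {w : (Fin d → ℝ) → ℝ} (hw : Measurable w) (N : ℕ) :
    Measurable fun x : Fin N → Fin d → ℝ => opNorm (I.gram B w x - 1) := by
  have hc : Continuous fun q : Fin N → B → ℝ =>
      opNorm ((N : ℝ)⁻¹ • ∑ i, Matrix.vecMulVec (q i) (q i) - 1) := by
    have h : Continuous fun q : Fin N → B → ℝ => ∑ i, Matrix.vecMulVec (q i) (q i) :=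
      continuous_finsetSum _ fun i _ => (continuous_apply i).matrix_vecMulVec (continuous_apply i)
    have h' : Continuous fun q : Fin N → B → ℝ =>
        (N : ℝ)⁻¹ • ∑ i, Matrix.vecMulVec (q i) (q i) - 1 :=
      (h.const_smul (N : ℝ)⁻¹).sub continuous_const
    exact continuous_opNorm.comp h'
  have hm : Measurable fun x : Fin N → Fin d → ℝ => fun i => weightedRow I B w (x i) :=
    measurable_pi_lambda _ fun i => (measurable_weightedRow I B hw).comp (measurable_pi_apply i)
  have h := hc.measurable.comp hm
  simp only [Function.comp_def] at h
  simpa only [InputModel.gram_eq, Matrix.sumVecMulVec] using h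

/-- The decay rate of the Gram matrix deviation of non-sparse-coupled samples. -/
noncomputable def decayRate (t t₀ : ℝ) (κ : ℝ → ℝ) : ℝ :=
  min (κ ((t₀ + t) / 2)) (((t - t₀) / 2) ^ 2 / 4 * (Real.log 2 / 4))

theorem decayRate_pos {t t₀ : ℝ} {κ : ℝ → ℝ} (h : t₀ < t) (hκ : ∀ τ ∈ Set.Icc t₀ t, 0 < κ τ) :
    0 < decayRate t t₀ κ := by
  have h2 : 0 < Real.log 2 := Real.log_pos (by norm_num)
  have h3 : 0 < t - t₀ := sub_pos.2 h
  exact lt_min (hκ _ ⟨by linarith, by linarith⟩) (by positivity)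

theorem NonSparseCoupled.measureReal_le {I : InputModel d} {it : Iterate d}
    {R : Reference I it.basis} {β : ℝ} {κ : ℝ → ℝ} {t₀ t : ℝ} (h : NonSparseCoupled I it R β κ t₀ t)
    {τ : ℝ} (hτ : τ ∈ Set.Icc t₀ t) :
    it.sampleLaw.real {x | t < opNorm (I.gram it.basis it.weight x - 1)} ≤
      β * Real.exp (-(κ τ * it.numSamples * R.mu⁻¹ * (Real.log it.basis.card)⁻¹)) +
      (Measure.pi fun _ : Fin it.numSamples => R.dist).real
        {x | t - τ < opNorm (I.gram it.basis R.weight x - 1)} := by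
  obtain ⟨π, h1, h2, h3⟩ := h
  -- The coupling inherits its total mass from its first marginal.
  have hp : IsFiniteMeasure π := by
    constructor
    have := measure_univ (μ := it.sampleLaw)
    rw [← h1, Measure.map_apply measurable_fst MeasurableSet.univ, Set.preimage_univ] at this
    simp [this]
  have m1 : MeasurableSet {x | t < opNorm (I.gram it.basis it.weight x - 1)} :=
    measurableSet_lt measurable_const
      (measurable_opNorm_gram_sub_one I it.basis it.measurable_weight it.numSamples)
  have m2 : MeasurableSet {x : Fin it.numSamples → Fin d → ℝ |
      t - τ < opNorm (I.gram it.basis R.weight x - 1)} :=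
    measurableSet_lt measurable_const
      (measurable_opNorm_gram_sub_one I it.basis R.measurable_weight it.numSamples)
  rw [← h2, ← h1, map_measureReal_apply measurable_fst m1, map_measureReal_apply measurable_snd m2]
  refine le_trans (measureReal_mono ?_) ((measureReal_union_le _ _).trans
    (add_le_add_left (h3 τ hτ) _))
  intro z hz
  by_contra hc
  simp only [Set.mem_union, Set.mem_ofPred_eq, Set.mem_preimage, not_or, not_lt] at hc hz
  have := opNorm_add_le (I.gram it.basis it.weight z.1 - I.gram it.basis R.weight z.2)
    (I.gram it.basis R.weight z.2 - 1)
  rw [sub_add_sub_cancel] at this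
  linarith [hc.1, hc.2]

/-- The threshold is split as `(t₀ + t) / 2` for the coupling plus `s = (t - t₀) / 2` for the
reference samples. The Chernoff prefactor `2|B|` is removed by separating small from large sample
sizes. -/
theorem NonSparseCoupled.measureReal_lt_opNorm_gram_sub_one_le {I : InputModel d} {it : Iterate d}
    {R : Reference I it.basis} {β : ℝ} {κ : ℝ → ℝ} {t₀ t : ℝ} (h : NonSparseCoupled I it R β κ t₀ t)
    (ht₀ : 0 < t₀) (ht₀t : t₀ < t) (ht : t ≤ 1) (hcard : 2 ≤ it.basis.card) :
    it.sampleLaw.real {x | t < opNorm (I.gram it.basis it.weight x - 1)} ≤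
      2 * max β 1 * Real.exp
        (-(decayRate t t₀ κ * it.numSamples * R.mu⁻¹ * (Real.log it.basis.card)⁻¹)) := by
  have hB : it.basis.Nonempty := Finset.card_pos.1 (by omega)
  have hμ : 0 < R.mu := zero_lt_one.trans_le (R.one_le_mu hB)
  have hlog2 : 0 < Real.log 2 := Real.log_pos (by norm_num)
  have hL2 : Real.log 2 ≤ Real.log it.basis.card :=
    Real.log_le_log (by norm_num) (by exact_mod_cast hcard)
  set L := Real.log it.basis.card with hL
  have hL0 : 0 < L := hlog2.trans_le hL2
  set s := (t - t₀) / 2 with hs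
  have hs0 : 0 < s := by rw [hs]; linarith
  set c := s ^ 2 / 4 with hc
  have hc0 : 0 < c := by positivity
  set y := (it.numSamples : ℝ) / R.mu with hy
  have hy0 : 0 ≤ y := by positivity
  have hrate : decayRate t t₀ κ ≤ c * (Real.log 2 / 4) := min_le_right _ _
  have hX : ∀ r : ℝ, r * it.numSamples * R.mu⁻¹ * L⁻¹ = r * (y / L) := fun r => by
    rw [hy]; ring
  rw [hX]
  by_cases hcase : c * y ≤ 2 * Real.log (2 * it.basis.card)
  -- Few samples: here `c * y ≤ 4 * L`, so the exponential is at least `1 / 2` and the claimed bound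
  -- is at least `1`.
  · have h1 : decayRate t t₀ κ * (y / L) ≤ Real.log 2 := by
      refine (mul_le_mul_of_nonneg_right hrate (by positivity)).trans ?_
      have h2 : Real.log (2 * it.basis.card) ≤ 2 * L := by
        rw [Real.log_mul (by norm_num) (by positivity)]; linarith
      have h3 : c * y / L ≤ 4 := by rw [div_le_iff₀ hL0]; linarith
      have e : c * (Real.log 2 / 4) * (y / L) = Real.log 2 / 4 * (c * y / L) := by ring
      rw [e]
      have := mul_le_mul_of_nonneg_left h3 (div_nonneg hlog2.le (by norm_num : (0 : ℝ) ≤ 4))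
      linarith
    have h2 : (1 : ℝ) ≤ 2 * Real.exp (-(decayRate t t₀ κ * (y / L))) := by
      have := Real.exp_le_exp.2 (neg_le_neg h1)
      rw [Real.exp_neg, Real.exp_log (by norm_num)] at this
      linarith
    have h3 : (1 : ℝ) ≤ max β 1 := le_max_right _ _
    have := measureReal_le_one (μ := it.sampleLaw)
      (s := {x | t < opNorm (I.gram it.basis it.weight x - 1)})
    nlinarith [Real.exp_pos (-(decayRate t t₀ κ * (y / L)))]
  · rw [not_le] at hcase
    have hlogpos : 0 ≤ Real.log (2 * it.basis.card) := Real.log_nonneg (by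
      have : (2 : ℝ) ≤ it.basis.card := by exact_mod_cast hcard
      linarith)
    have hN : 0 < it.numSamples := by
      rcases Nat.eq_zero_or_pos it.numSamples with h0 | h0
      · simp [hy, h0] at hcase; linarith
      · exact h0
    have h1 := h.measureReal_le (τ := (t₀ + t) / 2) ⟨by linarith, by linarith⟩
    have es : t - (t₀ + t) / 2 = s := by rw [hs]; ring
    rw [es, hX] at h1
    have h2 := R.measureReal_lt_opNorm_gram_sub_one_le hB hN hs0 (by rw [hs]; linarith)
    have hyL : 0 ≤ y / L := by positivity
    have h3 : Real.exp (-(κ ((t₀ + t) / 2) * (y / L))) ≤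
        Real.exp (-(decayRate t t₀ κ * (y / L))) :=
      Real.exp_le_exp.2 (neg_le_neg (mul_le_mul_of_nonneg_right (min_le_left _ _) hyL))
    -- Many samples: half of the exponent `c * y` absorbs `log (2|B|)`, and the other half exceeds
    -- the claimed exponent.
    have h4 : 2 * it.basis.card * Real.exp (-(c * y)) ≤
        Real.exp (-(decayRate t t₀ κ * (y / L))) := by
      have hpos : (0 : ℝ) < 2 * it.basis.card := by
        have : (0 : ℝ) < it.basis.card := by exact_mod_cast (by omega : 0 < it.basis.card)
        linarith
      conv_lhs => rw [← Real.exp_log hpos, ← Real.exp_add]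
      refine Real.exp_le_exp.2 ?_
      have h5 : decayRate t t₀ κ * (y / L) ≤ c * y / 4 := by
        refine (mul_le_mul_of_nonneg_right hrate hyL).trans ?_
        have e : c * (Real.log 2 / 4) * (y / L) = c * y / 4 * (Real.log 2 / L) := by ring
        rw [e]
        exact mul_le_of_le_one_right (by positivity) ((div_le_one hL0).2 hL2)
      have : 0 ≤ c * y := by positivity
      linarith
    have hβ1 : β ≤ max β 1 := le_max_left _ _
    have hβ2 : (1 : ℝ) ≤ max β 1 := le_max_right _ _
    have hE := Real.exp_pos (-(decayRate t t₀ κ * (y / L)))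
    have h6 : β * Real.exp (-(κ ((t₀ + t) / 2) * (y / L))) ≤
        max β 1 * Real.exp (-(decayRate t t₀ κ * (y / L))) :=
      mul_le_mul hβ1 h3 (Real.exp_nonneg _) (by linarith)
    nlinarith

end PolyChaos

/-! ### Dimension-free counting by weighted degree. -/

namespace PolyChaos

variable {d : ℕ}

/-- The weighted degree `∑ j, (j + 1)² k j` of a multi-index. -/
noncomputable def weightedDegree (k : Fin d → ℕ) : ℝ :=
  ∑ j : Fin d, ((j : ℝ) + 1) ^ 2 * (k j : ℝ)

/-- A dimension-free bound for `∑ k, exp (-σ * weightedDegree k)`. -/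
noncomputable def decaySum (σ : ℝ) : ℝ :=
  Real.exp ((1 - Real.exp (-σ))⁻¹ ^ 2)

theorem geom_sum_le_exp {q : ℝ} (h0 : 0 ≤ q) (h1 : q < 1) (M : ℕ) :
    ∑ m ∈ Finset.range M, q ^ m ≤ Real.exp (q / (1 - q)) := by
  have h : 0 < 1 - q := sub_pos.2 h1
  refine ((summable_geometric_of_lt_one h0 h1).sum_le_tsum _ fun i _ => pow_nonneg h0 i).trans ?_
  rw [tsum_geometric_of_lt_one h0 h1]
  refine le_trans (le_of_eq ?_) (Real.add_one_le_exp _)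
  field_simp
  ring

/-- The sum over a box factors into geometric sums, each at most `1 / (1 - q j) ≤ exp (q j / (1 - q
j))`. With `r = exp (-σ)`, `(j + 1)² ≥ j + 1` gives `q j ≤ r ^ (j + 1)`, so the exponents add up to
at most `(1 - r)⁻¹ ^ 2` in every dimension. -/
theorem sum_exp_neg_weightedDegree_le {σ : ℝ} (hσ : 0 < σ) (S : Finset (Fin d → ℕ)) :
    ∑ k ∈ S, Real.exp (-(σ * weightedDegree k)) ≤ decaySum σ := by
  obtain ⟨M, hM⟩ : ∃ M : ℕ, ∀ k ∈ S, ∀ j, k j < M := by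
    refine ⟨(S.sup fun k => ∑ j, k j) + 1, fun k hk j => Nat.lt_succ_of_le ?_⟩
    exact (Finset.single_le_sum (f := fun j => k j) (fun _ _ => Nat.zero_le _)
      (Finset.mem_univ j)).trans (Finset.le_sup (f := fun k : Fin d → ℕ => ∑ j, k j) hk)
  set q : Fin d → ℝ := fun j => Real.exp (-(σ * ((j : ℝ) + 1) ^ 2)) with hq
  set r := Real.exp (-σ) with hr
  have hr0 : 0 < r := Real.exp_pos _
  have hr1 : r < 1 := Real.exp_zero ▸ Real.exp_lt_exp.2 (by linarith)
  have hqr : ∀ j, q j ≤ r ^ (j : ℕ) * r := fun j => by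
    rw [hq, hr, ← pow_succ, ← Real.exp_nat_mul]
    refine Real.exp_le_exp.2 ?_
    push_cast
    have hj : (0 : ℝ) ≤ j := Nat.cast_nonneg _
    nlinarith [mul_nonneg hσ.le hj, mul_nonneg hσ.le (mul_nonneg hj hj)]
  have hqr' : ∀ j, q j ≤ r := fun j =>
    (hqr j).trans (mul_le_of_le_one_left hr0.le (pow_le_one₀ hr0.le hr1.le))
  have hterm : ∀ k : Fin d → ℕ, Real.exp (-(σ * weightedDegree k)) = ∏ j, q j ^ k j := fun k => by
    simp only [hq, ← Real.exp_nat_mul, ← Real.exp_sum, weightedDegree, Finset.mul_sum,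
      ← Finset.sum_neg_distrib]
    congr 1
    exact Finset.sum_congr rfl fun j _ => by ring
  have hsub : S ⊆ Fintype.piFinset fun _ : Fin d => Finset.range M := fun k hk => by
    rw [Fintype.mem_piFinset]
    exact fun j => Finset.mem_range.2 (hM k hk j)
  refine (Finset.sum_le_sum_of_subset_of_nonneg hsub fun _ _ _ => Real.exp_nonneg _).trans ?_
  simp only [hterm]
  rw [← Finset.prod_univ_sum (fun _ : Fin d => Finset.range M) (fun j m => q j ^ m)]
  have h1r : 0 < 1 - r := sub_pos.2 hr1
  refine (Finset.prod_le_prod (fun j _ => Finset.sum_nonneg fun m _ =>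
    pow_nonneg (Real.exp_nonneg _) m) fun j _ =>
    geom_sum_le_exp (Real.exp_nonneg _) ((hqr' j).trans_lt hr1) M).trans ?_
  rw [← Real.exp_sum, decaySum]
  refine Real.exp_le_exp.2 ?_
  have h2 : ∀ j : Fin d, q j / (1 - q j) ≤ r ^ (j : ℕ) * (1 - r)⁻¹ := fun j => by
    rw [div_eq_mul_inv]
    refine mul_le_mul ((hqr j).trans (mul_le_of_le_one_right (by positivity) hr1.le))
      (inv_anti₀ h1r (by linarith [hqr' j])) ?_ (by positivity)
    exact inv_nonneg.2 (by linarith [hqr' j])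
  refine (Finset.sum_le_sum fun j _ => h2 j).trans ?_
  rw [← Finset.sum_mul, Fin.sum_univ_eq_sum_range (fun i => r ^ i), sq]
  refine mul_le_mul_of_nonneg_right ?_ (by positivity)
  rw [← tsum_geometric_of_lt_one hr0.le hr1]
  exact (summable_geometric_of_lt_one hr0.le hr1).sum_le_tsum _ fun i _ => pow_nonneg hr0.le i

/-- The order whose anisotropic basis consists of the multi-indices of weighted degree at most
`L`. -/
noncomputable def decayOrder (d : ℕ) (L : ℝ) (j : Fin d) : ℝ := L / ((j : ℝ) + 1) ^ 2

theorem decayOrder_nonneg {L : ℝ} (hL : 0 ≤ L) (j : Fin d) : 0 ≤ decayOrder d L j := by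
  unfold decayOrder; positivity

theorem mem_anisoBasis_decayOrder {L : ℝ} (hL : 0 < L) (k : Fin d → ℕ) :
    k ∈ anisoBasis (decayOrder d L) (decayOrder_nonneg hL.le) ↔ weightedDegree k ≤ L := by
  have hpos : ∀ j, 0 < decayOrder d L j := fun j => by unfold decayOrder; positivity
  have e : ∑ j, (k j : ℝ) / decayOrder d L j = weightedDegree k / L := by
    rw [weightedDegree, Finset.sum_div]
    refine Finset.sum_congr rfl fun j _ => ?_
    rw [decayOrder]
    field_simp
  rw [anisoBasis, Set.Finite.mem_toFinset, anisoSet, Set.mem_ofPred_eq, e, div_le_one hL]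
  exact and_iff_right fun j hj => absurd hj (hpos j).ne'

/-- Rankin's trick: each counted index contributes at least `1` to `∑ exp (L - weightedDegree k)`.
-/
theorem card_anisoBasis_decayOrder_le {L : ℝ} (hL : 0 < L) :
    ((anisoBasis (decayOrder d L) (decayOrder_nonneg hL.le)).card : ℝ) ≤
      Real.exp L * decaySum 1 := by
  have h := mul_le_mul_of_nonneg_left (sum_exp_neg_weightedDegree_le one_pos
    (anisoBasis (decayOrder d L) (decayOrder_nonneg hL.le))) (Real.exp_nonneg L)
  refine le_trans ?_ h
  rw [Finset.mul_sum, Finset.card_eq_sum_ones, Nat.cast_sum]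
  refine Finset.sum_le_sum fun k hk => ?_
  rw [← Real.exp_add, Nat.cast_one, Real.one_le_exp_iff]
  linarith [(mem_anisoBasis_decayOrder hL k).1 hk]

/-! ### Mean-square errors of truncations and surrogates. -/

namespace InputModel

variable (I : InputModel d)

instance : IsProbabilityMeasure I.law := inferInstanceAs (IsProbabilityMeasure (Measure.pi _))

theorem integrable_psi_mul_psi (k l : Fin d → ℕ) :
    Integrable (fun ξ => I.psi k ξ * I.psi l ξ) I.law := by
  simp only [psi, ← Finset.prod_mul_distrib]
  exact Integrable.fintype_prod (f := fun i x => (I.poly i (k i)).eval x * (I.poly i (l i)).eval x)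
    fun i => (I.memLp_poly i (k i)).integrable_mul (I.memLp_poly i (l i))

theorem integral_psi_mul_psi (k l : Fin d → ℕ) :
    ∫ ξ, I.psi k ξ * I.psi l ξ ∂(I.law) = if k = l then 1 else 0 := by
  simp only [psi, ← Finset.prod_mul_distrib]
  rw [law, integral_fintype_prod_eq_prod
    (f := fun i x => (I.poly i (k i)).eval x * (I.poly i (l i)).eval x)]
  simp only [I.orthonormal]
  rw [Finset.prod_ite_zero]
  simp [funext_iff]

theorem memLp_psi (k : Fin d → ℕ) : MemLp (I.psi k) 2 I.law := by
  rw [memLp_two_iff_integrable_sq (I.continuous_psi k).aestronglyMeasurable]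
  simpa only [sq] using I.integrable_psi_mul_psi k k

theorem memLp_sum (S : Finset (Fin d → ℕ)) (c : (Fin d → ℕ) → ℝ) :
    MemLp (fun ξ => ∑ k ∈ S, c k * I.psi k ξ) 2 I.law :=
  memLp_finsetSum S fun k _ => (I.memLp_psi k).const_mul (c k)

theorem integral_sum_sq (S : Finset (Fin d → ℕ)) (c : (Fin d → ℕ) → ℝ) :
    ∫ ξ, (∑ k ∈ S, c k * I.psi k ξ) ^ 2 ∂(I.law) = ∑ k ∈ S, c k ^ 2 := by
  have e : ∀ ξ, (∑ k ∈ S, c k * I.psi k ξ) ^ 2 =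
      ∑ k ∈ S, ∑ l ∈ S, c k * c l * (I.psi k ξ * I.psi l ξ) := fun ξ => by
    rw [sq, Finset.sum_mul_sum]
    exact Finset.sum_congr rfl fun k _ => Finset.sum_congr rfl fun l _ => by ring
  simp only [e]
  rw [integral_finsetSum _ fun k _ => integrable_finsetSum _ fun l _ =>
    (I.integrable_psi_mul_psi k l).const_mul _]
  refine Finset.sum_congr rfl fun k hk => ?_
  rw [integral_finsetSum _ fun l _ => (I.integrable_psi_mul_psi k l).const_mul _]
  simp only [integral_const_mul, integral_psi_mul_psi]
  simp [hk, sq]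

variable {I} {u : (Fin d → ℝ) → ℝ}

theorem integral_sub_sum_coeff_sq (hu : MemLp u 2 I.law) (S : Finset (Fin d → ℕ)) :
    ∫ ξ, (u ξ - ∑ k ∈ S, I.coeff u k * I.psi k ξ) ^ 2 ∂(I.law) =
      ∫ ξ, u ξ ^ 2 ∂(I.law) - ∑ k ∈ S, I.coeff u k ^ 2 := by
  have hup : ∀ k, Integrable (fun ξ => u ξ * I.psi k ξ) I.law := fun k =>
    hu.integrable_mul (I.memLp_psi k)
  have e : ∀ ξ, (u ξ - ∑ k ∈ S, I.coeff u k * I.psi k ξ) ^ 2 =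
      u ξ ^ 2 - 2 * ∑ k ∈ S, I.coeff u k * (u ξ * I.psi k ξ) +
        (∑ k ∈ S, I.coeff u k * I.psi k ξ) ^ 2 := fun ξ => by
    have : ∑ k ∈ S, I.coeff u k * (u ξ * I.psi k ξ) =
        u ξ * ∑ k ∈ S, I.coeff u k * I.psi k ξ := by
      rw [Finset.mul_sum]
      exact Finset.sum_congr rfl fun k _ => by ring
    rw [this]; ring
  have hs : Integrable (fun ξ => ∑ k ∈ S, I.coeff u k * (u ξ * I.psi k ξ)) I.law :=
    integrable_finsetSum _ fun k _ => (hup k).const_mul _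
  have hd : Integrable (fun ξ => u ξ ^ 2 - 2 * ∑ k ∈ S, I.coeff u k * (u ξ * I.psi k ξ)) I.law :=
    hu.integrable_sq.sub (hs.const_mul 2)
  simp only [e]
  rw [integral_add hd (I.memLp_sum S _).integrable_sq,
    integral_sub hu.integrable_sq (hs.const_mul 2), integral_const_mul,
    integral_finsetSum _ fun k _ => (hup k).const_mul _, integral_sum_sq]
  have : ∀ k, ∫ ξ, I.coeff u k * (u ξ * I.psi k ξ) ∂(I.law) = I.coeff u k ^ 2 := fun k => by
    rw [integral_const_mul, sq]; rfl
  simp only [this]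
  ring

/-- Exponential decay of the coefficients bounds the truncation error of every basis that contains
the multi-indices of weighted degree at most `L`. -/
theorem integral_sub_sum_coeff_sq_le (hu : MemLp u 2 I.law) (hexp : I.HasExpansion u)
    {A α L : ℝ} (hα : 0 < α)
    (hdecay : ∀ k, |I.coeff u k| ≤ A * Real.exp (-(α * weightedDegree k)))
    {B : Finset (Fin d → ℕ)} (hB : ∀ k ∉ B, L ≤ weightedDegree k) :
    ∫ ξ, (u ξ - ∑ k ∈ B, I.coeff u k * I.psi k ξ) ^ 2 ∂(I.law) ≤
      A ^ 2 * decaySum α * Real.exp (-(α * L)) := by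
  -- The error of `B` exceeds that of any larger `S` by at most this constant, and the error of `S`
  -- tends to `0`.
  have hlim := hexp.add_const (A ^ 2 * decaySum α * Real.exp (-(α * L)))
  rw [zero_add] at hlim
  refine ge_of_tendsto hlim ((eventually_ge_atTop B).mono fun S hS => ?_)
  rw [integral_sub_sum_coeff_sq hu, integral_sub_sum_coeff_sq hu, ← Finset.sum_sdiff hS]
  have hterm : ∀ k ∈ S \ B, I.coeff u k ^ 2 ≤
      A ^ 2 * Real.exp (-(α * L)) * Real.exp (-(α * weightedDegree k)) := fun k hk => by
    rw [← sq_abs]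
    refine (pow_le_pow_left₀ (abs_nonneg _) (hdecay k) 2).trans ?_
    -- Of the two equal exponential factors, one is bounded by `exp (-(α * L))` and the other is
    -- kept for summation.
    rw [mul_pow, sq (Real.exp _), mul_assoc]
    refine mul_le_mul_of_nonneg_left (mul_le_mul_of_nonneg_right (Real.exp_le_exp.2 ?_)
      (Real.exp_nonneg _)) (sq_nonneg A)
    exact neg_le_neg (mul_le_mul_of_nonneg_left (hB k (Finset.mem_sdiff.1 hk).2) hα.le)
  have hsum := Finset.sum_le_sum hterm
  rw [← Finset.mul_sum] at hsum
  have h2 := mul_le_mul_of_nonneg_left (sum_exp_neg_weightedDegree_le hα (S \ B))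
    (mul_nonneg (sq_nonneg A) (Real.exp_nonneg (-(α * L))))
  have e : A ^ 2 * Real.exp (-(α * L)) * decaySum α = A ^ 2 * decaySum α * Real.exp (-(α * L)) := by
    ring
  linarith

theorem surrogate_coeff (B : Finset (Fin d → ℕ)) (c : (Fin d → ℕ) → ℝ) (ξ : Fin d → ℝ) :
    I.surrogate B (fun k => c k) ξ = ∑ k ∈ B, c k * I.psi k ξ :=
  Finset.sum_coe_sort B fun k => c k * I.psi k ξ

theorem exists_extension (B : Finset (Fin d → ℕ)) (c : B → ℝ) :
    ∃ c' : (Fin d → ℕ) → ℝ, c = fun k : B => c' k := by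
  classical
  exact ⟨fun k => if h : k ∈ B then c ⟨k, h⟩ else 0, by ext k; simp⟩

theorem memLp_surrogate (B : Finset (Fin d → ℕ)) (c : B → ℝ) :
    MemLp (I.surrogate B c) 2 I.law := by
  obtain ⟨c', rfl⟩ := exists_extension B c
  have := I.memLp_sum B c'
  simpa only [← surrogate_coeff] using this

theorem integral_surrogate_sub_sq (B : Finset (Fin d → ℕ)) (c c' : B → ℝ) :
    ∫ ξ, (I.surrogate B c ξ - I.surrogate B c' ξ) ^ 2 ∂(I.law) = ∑ k, (c k - c' k) ^ 2 := by
  obtain ⟨b, rfl⟩ := exists_extension B c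
  obtain ⟨b', rfl⟩ := exists_extension B c'
  have h := I.integral_sum_sq B fun k => b k - b' k
  rw [Finset.sum_coe_sort B fun k => (b k - b' k) ^ 2, ← h]
  simp only [surrogate_coeff, ← Finset.sum_sub_distrib, ← sub_mul]

theorem rmse_sq (u v : (Fin d → ℝ) → ℝ) :
    I.rmse u v ^ 2 = ∫ ξ, (v ξ - u ξ) ^ 2 ∂(I.law) :=
  Real.sq_sqrt (integral_nonneg fun _ => sq_nonneg _)

theorem rmse_nonneg (u v : (Fin d → ℝ) → ℝ) : 0 ≤ I.rmse u v := Real.sqrt_nonneg _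

theorem rrmse_le_of_rmse_sq_le {v : (Fin d → ℝ) → ℝ} {ε : ℝ} (hε : 0 ≤ ε)
    (hV : 0 < ∫ ξ, u ξ ^ 2 ∂(I.law)) (h : I.rmse u v ^ 2 ≤ ε ^ 2 * ∫ ξ, u ξ ^ 2 ∂(I.law)) :
    I.rrmse u v ≤ ε := by
  rw [rrmse, div_le_iff₀ (Real.sqrt_pos.2 hV)]
  refine (sq_le_sq₀ (rmse_nonneg _ _) (by positivity)).1 ?_
  rwa [mul_pow, Real.sq_sqrt hV.le]

theorem IsBest.rmse_sq_le (hV : 0 < ∫ ξ, u ξ ^ 2 ∂(I.law)) {B : Finset (Fin d → ℕ)} {c : B → ℝ}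
    (hc : I.IsBest u B c) :
    I.rmse u (I.surrogate B c) ^ 2 ≤
      ∫ ξ, (u ξ - ∑ k ∈ B, I.coeff u k * I.psi k ξ) ^ 2 ∂(I.law) := by
  have h := (div_le_div_iff_of_pos_right (Real.sqrt_pos.2 hV)).1 (hc fun k => I.coeff u k)
  refine (pow_le_pow_left₀ (rmse_nonneg _ _) h 2).trans (le_of_eq ?_)
  rw [rmse_sq]
  simp only [surrogate_coeff]
  exact integral_congr_ae (Eventually.of_forall fun ξ => sub_sq_comm _ _)

/-- `(a + b)² ≤ 2a² + 2b²`, with the distance between surrogates computed by orthonormality. -/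
theorem rmse_surrogate_sq_le (hu : MemLp u 2 I.law) (B : Finset (Fin d → ℕ)) (c c' : B → ℝ) :
    I.rmse u (I.surrogate B c') ^ 2 ≤
      2 * ∑ k, (c' k - c k) ^ 2 + 2 * I.rmse u (I.surrogate B c) ^ 2 := by
  have h1 : Integrable (fun ξ => (I.surrogate B c' ξ - I.surrogate B c ξ) ^ 2) I.law :=
    ((memLp_surrogate B c').sub (memLp_surrogate B c)).integrable_sq
  have h2 : Integrable (fun ξ => (I.surrogate B c ξ - u ξ) ^ 2) I.law :=
    ((memLp_surrogate B c).sub hu).integrable_sq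
  rw [rmse_sq, rmse_sq, ← integral_surrogate_sub_sq, ← integral_const_mul, ← integral_const_mul,
    ← integral_add (h1.const_mul 2) (h2.const_mul 2)]
  refine integral_mono ((memLp_surrogate B c').sub hu).integrable_sq
    ((h1.const_mul 2).add (h2.const_mul 2)) fun ξ => ?_
  simp only
  nlinarith [sq_nonneg (I.surrogate B c' ξ - I.surrogate B c ξ - (I.surrogate B c ξ - u ξ))]

end InputModel

/-! ### Recovery from a well-conditioned design matrix. -/

theorem dotProduct_mulVec_le_opNorm {n : Type*} [Fintype n] [DecidableEq n] (A : Matrix n n ℝ)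
    (v : n → ℝ) : |v ⬝ᵥ A.mulVec v| ≤ opNorm A * ∑ k, v k ^ 2 := by
  set x : EuclideanSpace ℝ n := WithLp.toLp 2 v with hx
  have h1 := abs_real_inner_le_norm x (Matrix.toEuclideanCLM (n := n) (𝕜 := ℝ) A x)
  have h2 := (Matrix.toEuclideanCLM (n := n) (𝕜 := ℝ) A).le_opNorm x
  have h3 : ‖x‖ ^ 2 = ∑ k, v k ^ 2 := by
    rw [EuclideanSpace.norm_sq_eq]; simp [hx]
  have h4 : inner ℝ x (Matrix.toEuclideanCLM (n := n) (𝕜 := ℝ) A x) = v ⬝ᵥ A.mulVec v := by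
    simp [hx, PiLp.inner_apply, dotProduct, mul_comm]
  rw [h4] at h1
  rw [← h3]
  refine h1.trans ((mul_le_mul_of_nonneg_left h2 (norm_nonneg x)).trans (le_of_eq ?_))
  rw [opNorm]; ring

namespace InputModel

variable {I : InputModel d} {u : (Fin d → ℝ) → ℝ}

theorem sum_sq_le_of_opNorm_gram_sub_one_le {B : Finset (Fin d → ℕ)} {w : (Fin d → ℝ) → ℝ} {N : ℕ}
    {x : Fin N → Fin d → ℝ} {t : ℝ} (h : opNorm (I.gram B w x - 1) ≤ t) (v : B → ℝ) :
    (1 - t) * ∑ k, v k ^ 2 ≤ ∑ i, ((I.design B w x).mulVec v i) ^ 2 := by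
  have h1 := (neg_le_abs _).trans (dotProduct_mulVec_le_opNorm (I.gram B w x - 1) v)
  have h2 : v ⬝ᵥ (I.gram B w x - 1).mulVec v =
      ∑ i, ((I.design B w x).mulVec v i) ^ 2 - ∑ k, v k ^ 2 := by
    rw [Matrix.sub_mulVec, Matrix.one_mulVec, dotProduct_sub, gram, ← Matrix.mulVec_mulVec,
      Matrix.dotProduct_mulVec, Matrix.vecMul_transpose]
    simp only [dotProduct, sq]
  have h3 : 0 ≤ ∑ k, v k ^ 2 := Finset.sum_nonneg fun k _ => sq_nonneg _
  have h4 := mul_le_mul_of_nonneg_right h h3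
  linarith

/-- The data cancel: `D (c' - c)` is the difference of the two residuals. -/
theorem sum_mulVec_sub_sq_le {B : Finset (Fin d → ℕ)} {w : (Fin d → ℝ) → ℝ} {N : ℕ}
    (x : Fin N → Fin d → ℝ) (c c' : B → ℝ) :
    ∑ i, ((I.design B w x).mulVec (c' - c) i) ^ 2 ≤
      2 * I.residNorm u B w x c ^ 2 + 2 * I.residNorm u B w x c' ^ 2 := by
  rw [residNorm, residNorm, Real.sq_sqrt (Finset.sum_nonneg fun i _ => sq_nonneg _),
    Real.sq_sqrt (Finset.sum_nonneg fun i _ => sq_nonneg _), Finset.mul_sum, Finset.mul_sum,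
    ← Finset.sum_add_distrib]
  refine Finset.sum_le_sum fun i _ => ?_
  rw [Matrix.mulVec_sub, Pi.sub_apply]
  nlinarith [sq_nonneg (2 * (rowWeight w x i * u (x i)) - (I.design B w x).mulVec c i -
    (I.design B w x).mulVec c' i)]

/-- Recovery from a well-conditioned design matrix, for any coefficients that satisfy the residual
constraint. -/
theorem rmse_surrogate_sq_le_of_residNorm_le (hu : MemLp u 2 I.law) {B : Finset (Fin d → ℕ)}
    {w : (Fin d → ℝ) → ℝ} {N : ℕ} {x : Fin N → Fin d → ℝ} {t Λ η : ℝ} (ht : t < 1)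
    (hG : opNorm (I.gram B w x - 1) ≤ t) {c c' : B → ℝ} (hc : I.residNorm u B w x c ≤ η)
    (hc' : I.residNorm u B w x c' ≤ η) (hη : η ≤ Λ * I.rmse u (I.surrogate B c)) :
    I.rmse u (I.surrogate B c') ^ 2 ≤
      2 * (1 + 4 * Λ ^ 2 / (1 - t)) * I.rmse u (I.surrogate B c) ^ 2 := by
  have h1t : 0 < 1 - t := sub_pos.2 ht
  have h0 : 0 ≤ I.residNorm u B w x c := Real.sqrt_nonneg _
  have h0' : 0 ≤ I.residNorm u B w x c' := Real.sqrt_nonneg _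
  have h1 := pow_le_pow_left₀ h0 (hc.trans hη) 2
  have h2 := pow_le_pow_left₀ h0' (hc'.trans hη) 2
  rw [mul_pow] at h1 h2
  have h3 := (sum_sq_le_of_opNorm_gram_sub_one_le hG (c' - c)).trans
    (sum_mulVec_sub_sq_le (u := u) x c c')
  have h4 : ∑ k, (c' k - c k) ^ 2 ≤ 4 * Λ ^ 2 / (1 - t) * I.rmse u (I.surrogate B c) ^ 2 := by
    rw [div_mul_eq_mul_div, le_div_iff₀ h1t, mul_comm]
    simp only [Pi.sub_apply] at h3
    linarith
  have h5 := rmse_surrogate_sq_le hu B c c'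
  linarith

end InputModel

/-! ### Choice of the constants. -/

/-- The factor by which recovery amplifies the squared error of the coefficient tail, relative to
the second moment `V`. -/
noncomputable def errorFactor (t A α V Λ : ℝ) : ℝ :=
  2 * (1 + 4 * Λ ^ 2 / (1 - t)) * (A ^ 2 * decaySum α) / V

/-- The ratio of the cutoff for the weighted degree to `log (1 / ε)`. -/
noncomputable def cutoffRate (t A α V Λ : ℝ) : ℝ :=
  (2 + |Real.log (errorFactor t A α V Λ)| / -Real.log 0.9) / α

/-- The exponent in the cardinality of the recovery basis. -/
noncomputable def cardExponent (t A α V Λ : ℝ) : ℝ :=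
  cutoffRate t A α V Λ + (1 - Real.exp (-1))⁻¹ ^ 2 / -Real.log 0.9

section Constants

variable {t A α V Λ ε : ℝ}

theorem neg_log_pos : 0 < -Real.log 0.9 :=
  neg_pos.2 (Real.log_neg (by norm_num) (by norm_num))

theorem neg_log_lt (h0 : 0 < ε) (h1 : ε < 0.9) : -Real.log 0.9 < -Real.log ε :=
  neg_lt_neg (Real.log_lt_log h0 h1)

theorem cutoffRate_pos (hα : 0 < α) : 0 < cutoffRate t A α V Λ := by
  have := neg_log_pos
  unfold cutoffRate; positivity

theorem cardExponent_pos (hα : 0 < α) : 0 < cardExponent t A α V Λ :=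
  add_pos_of_pos_of_nonneg (cutoffRate_pos hα) (div_nonneg (sq_nonneg _) neg_log_pos.le)

/-- In `cutoffRate` the `2` produces `ε ^ 2`. The other term compensates `errorFactor`, because `ε <
0.9` makes `-log ε / -log 0.9` at least `1`. -/
theorem errorFactor_mul_exp_le (ht : t < 1) (hA : 0 < A) (hα : 0 < α) (hV : 0 < V)
    (h0 : 0 < ε) (h1 : ε < 0.9) :
    2 * (1 + 4 * Λ ^ 2 / (1 - t)) * (A ^ 2 * decaySum α *
      Real.exp (-(α * (cutoffRate t A α V Λ * -Real.log ε)))) ≤ ε ^ 2 * V := by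
  have h1t : 0 < 1 - t := sub_pos.2 ht
  have hS : 0 < decaySum α := Real.exp_pos _
  have hM : 0 < errorFactor t A α V Λ := by unfold errorFactor; positivity
  have hl := neg_log_pos
  have hlε := neg_log_lt h0 h1
  have hV' : 2 * (1 + 4 * Λ ^ 2 / (1 - t)) * (A ^ 2 * decaySum α) = errorFactor t A α V Λ * V := by
    rw [errorFactor, div_mul_cancel₀ _ hV.ne']
  have hε2 : ε ^ 2 = Real.exp (-(2 * -Real.log ε)) := by
    rw [mul_neg, neg_neg, two_mul, Real.exp_add, Real.exp_log h0, sq]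
  rw [← mul_assoc, hV', mul_right_comm, hε2]
  refine mul_le_mul_of_nonneg_right ?_ hV.le
  conv_lhs => rw [← Real.exp_log hM, ← Real.exp_add]
  refine Real.exp_le_exp.2 ?_
  have e : α * (cutoffRate t A α V Λ * -Real.log ε) = 2 * -Real.log ε +
      |Real.log (errorFactor t A α V Λ)| * (-Real.log ε / -Real.log 0.9) := by
    rw [cutoffRate]; field_simp; ring
  rw [e]
  have h2 : (1 : ℝ) ≤ -Real.log ε / -Real.log 0.9 := (one_le_div hl).2 hlε.le
  have h3 := mul_le_mul_of_nonneg_left h2 (abs_nonneg (Real.log (errorFactor t A α V Λ)))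
  have h4 := le_abs_self (Real.log (errorFactor t A α V Λ))
  linarith

/-- The second term of `cardExponent` turns the constant `decaySum 1` into a power of `1 / ε`, again
because `ε < 0.9`. -/
theorem exp_mul_decaySum_le (h0 : 0 < ε) (h1 : ε < 0.9) :
    Real.exp (cutoffRate t A α V Λ * -Real.log ε) * decaySum 1 ≤
      ε ^ (-cardExponent t A α V Λ) := by
  have hl := neg_log_pos
  have hlε := neg_log_lt h0 h1
  rw [Real.rpow_def_of_pos h0, decaySum, ← Real.exp_add]
  refine Real.exp_le_exp.2 ?_
  set s := (1 - Real.exp (-1))⁻¹ ^ 2 with hs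
  have e : Real.log ε * -cardExponent t A α V Λ =
      cutoffRate t A α V Λ * -Real.log ε + s * (-Real.log ε / -Real.log 0.9) := by
    rw [cardExponent, ← hs]; ring
  rw [e]
  have h2 : (1 : ℝ) ≤ -Real.log ε / -Real.log 0.9 := (one_le_div hl).2 hlε.le
  have h3 := mul_le_mul_of_nonneg_left h2 (sq_nonneg (1 - Real.exp (-1))⁻¹)
  linarith

end Constants

/-- With enough samples, the exponential tail bound is at most `exp (-C)`. -/
theorem mul_exp_le_exp_neg {β' κ' μ ε ν C N : ℝ} {b : ℕ} (hβ : 1 ≤ β') (hκ : 0 < κ') (hμ : 0 < μ)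
    (hε : 0 < ε) (hb : 2 ≤ b) (hcard : (b : ℝ) ≤ ε ^ (-ν)) (hC : 0 ≤ C + Real.log (2 * β'))
    (hN : -ν * Real.log ε * (C + Real.log (2 * β')) * κ'⁻¹ * μ ≤ N) :
    2 * β' * Real.exp (-(κ' * N * μ⁻¹ * (Real.log b)⁻¹)) ≤ Real.exp (-C) := by
  have hb' : (2 : ℝ) ≤ b := by exact_mod_cast hb
  have hL0 : 0 < Real.log b := Real.log_pos (by linarith)
  -- The factor `-ν * log ε` in the sample count pays for the `log |B|` dividing the exponent.
  have hL : Real.log b ≤ -ν * Real.log ε := by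
    have := Real.log_le_log (by linarith) hcard
    rwa [Real.log_rpow hε] at this
  have hpos : 0 < 2 * β' := by linarith
  have key : C + Real.log (2 * β') ≤ κ' * N * μ⁻¹ * (Real.log b)⁻¹ := by
    rw [← div_eq_mul_inv, le_div_iff₀ hL0, ← div_eq_mul_inv, le_div_iff₀ hμ]
    have h1 := mul_le_mul_of_nonneg_left hN hκ.le
    have e : κ' * (-ν * Real.log ε * (C + Real.log (2 * β')) * κ'⁻¹ * μ) =
        (C + Real.log (2 * β')) * (-ν * Real.log ε) * μ := by
      field_simp
    rw [e] at h1
    exact (mul_le_mul_of_nonneg_right (mul_le_mul_of_nonneg_left hL hC) hμ.le).trans h1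
  conv_lhs => rw [← Real.exp_log hpos, ← Real.exp_add]
  exact Real.exp_le_exp.2 (by linarith)

end PolyChaos

/-! ### Assembly of the concentration, approximation and recovery bounds. -/

theorem mainTheorem5 (t : ℝ) (ht0 : 0 < t) (ht : t < 3 / (4 + √6)) :
    ∃ (ν₀ : ℝ → ℝ → ℝ → ℝ → ℝ) (κ' : ℝ → ℝ → (ℝ → ℝ) → ℝ),
      -- the constants are positive
      (∀ A α V Λ : ℝ, 0 < A → 0 < α → 0 < V → 0 < Λ → 0 < ν₀ A α V Λ) ∧
      (∀ (t₀ β : ℝ) (κ : ℝ → ℝ), 0 < t₀ → t₀ < t → 0 ≤ β → (∀ τ ∈ Set.Icc t₀ t, 0 < κ τ) →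
        0 < κ' t₀ β κ) ∧
      -- `κ'` is the decay rate of the Gram matrix deviation of non-sparse-coupled samples
      (∀ (t₀ β : ℝ) (κ : ℝ → ℝ), 0 < t₀ → t₀ < t → 0 ≤ β → (∀ τ ∈ Set.Icc t₀ t, 0 < κ τ) →
        ∀ (d : ℕ) (I : PolyChaos.InputModel d) (it : PolyChaos.Iterate d)
          (R : PolyChaos.Reference I it.basis),
          2 ≤ it.basis.card → PolyChaos.NonSparseCoupled I it R β κ t₀ t →
          it.sampleLaw.real {x | t < PolyChaos.opNorm (I.gram it.basis it.weight x - 1)} ≤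
            2 * max β 1 * Real.exp
              (-(κ' t₀ β κ * it.numSamples * R.mu⁻¹ * (Real.log it.basis.card)⁻¹))) ∧
      -- recovery
      (∀ A α V Λ : ℝ, 0 < A → 0 < α → 0 < V → 0 < Λ →
        ∀ (d : ℕ) (I : PolyChaos.InputModel d) (u : (Fin d → ℝ) → ℝ),
          Measurable u → MeasureTheory.MemLp u 2 I.law → I.HasExpansion u →
          ∫ ξ, u ξ ^ 2 ∂I.law = V →
          (∀ k : Fin d → ℕ,
            |I.coeff u k| ≤ A * Real.exp (-(α * ∑ j : Fin d, ((j : ℝ) + 1) ^ 2 * (k j : ℝ)))) →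
          ∀ ε : ℝ, 0 < ε → ε < 0.9 →
            ∃ (p : Fin d → ℝ) (hp : ∀ i, 0 ≤ p i),
              ((PolyChaos.anisoBasis p hp).card : ℝ) ≤ ε ^ (-ν₀ A α V Λ) ∧
              (∀ c, I.IsBest u (PolyChaos.anisoBasis p hp) c →
                I.rrmse u (I.surrogate (PolyChaos.anisoBasis p hp) c) ≤ ε) ∧
              ∀ (ν : ℝ) (t₀ β : ℝ) (κ : ℝ → ℝ) (C : ℝ), ν₀ A α V Λ ≤ ν →
                0 < t₀ → t₀ < t → 0 ≤ β → (∀ τ ∈ Set.Icc t₀ t, 0 < κ τ) →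
                ∀ (it : PolyChaos.Iterate d) (R : PolyChaos.Reference I it.basis),
                  2 ≤ it.basis.card →
                  PolyChaos.NonSparseCoupled I it R β κ t₀ t →
                  PolyChaos.anisoBasis p hp ⊆ it.basis →
                  (it.basis.card : ℝ) ≤ ε ^ (-ν) →
                  -ν * Real.log ε * (C + Real.log (2 * max β 1)) * (κ' t₀ β κ)⁻¹ * R.mu ≤
                    it.numSamples →
                  ∃ G : Set (Fin it.numSamples → Fin d → ℝ), MeasurableSet G ∧
                    1 - Real.exp (-C) ≤ it.sampleLaw.real G ∧
                    ∀ x ∈ G, ∀ (ctil chat : it.basis → ℝ) (δ : ℝ),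
                      I.IsBest u it.basis ctil →
                      I.residNorm u it.basis it.weight x ctil ≤
                        δ * PolyChaos.dataNorm u it.weight x →
                      δ * PolyChaos.dataNorm u it.weight x ≤
                        Λ * I.rmse u (I.surrogate it.basis ctil) →
                      I.IsBPDN u it.basis it.weight x δ chat →
                      I.rrmse u (I.surrogate it.basis chat) ≤ ε) := by
  have ht1 : t < 1 := ht.trans_le ((div_le_one (by positivity)).2
    (by linarith [Real.sqrt_nonneg 6]))
  refine ⟨PolyChaos.cardExponent t, fun t₀ _ κ => PolyChaos.decayRate t t₀ κ,
    fun A α V Λ _ hα _ _ => PolyChaos.cardExponent_pos hα,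
    fun t₀ β κ _ h _ hκ => PolyChaos.decayRate_pos h hκ,
    fun t₀ β κ h0 h _ hκ d I it R hcard hcoup =>
      hcoup.measureReal_lt_opNorm_gram_sub_one_le h0 h ht1.le hcard, ?_⟩
  intro A α V Λ hA hα hV _ d I u _ hu hexp hVeq hdecay ε hε hε1
  subst hVeq
  set V := ∫ ξ, u ξ ^ 2 ∂I.law with hVdef
  set L := PolyChaos.cutoffRate t A α V Λ * -Real.log ε with hL
  have hL0 : 0 < L := mul_pos (PolyChaos.cutoffRate_pos hα)
    (PolyChaos.neg_log_pos.trans (PolyChaos.neg_log_lt hε hε1))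
  have h1t : 0 < 1 - t := sub_pos.2 ht1
  set E := A ^ 2 * PolyChaos.decaySum α * Real.exp (-(α * L)) with hE
  have hE0 : 0 ≤ E := mul_nonneg (mul_nonneg (sq_nonneg A) (Real.exp_nonneg _)) (Real.exp_nonneg _)
  have hEle : 2 * (1 + 4 * Λ ^ 2 / (1 - t)) * E ≤ ε ^ 2 * V :=
    PolyChaos.errorFactor_mul_exp_le ht1 hA hα hV hε hε1
  -- Since the recovery factor exceeds `1`, the cutoff chosen for recovery also makes the best
  -- approximation in `B₀` accurate to `ε`.
  have hfac : 2 ≤ 2 * (1 + 4 * Λ ^ 2 / (1 - t)) := by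
    have : 0 ≤ 4 * Λ ^ 2 / (1 - t) := by positivity
    linarith
  set B₀ := PolyChaos.anisoBasis (PolyChaos.decayOrder d L)
    (PolyChaos.decayOrder_nonneg hL0.le) with hB₀
  have hbest : ∀ (B : Finset (Fin d → ℕ)) (c : B → ℝ), B₀ ⊆ B → I.IsBest u B c →
      I.rmse u (I.surrogate B c) ^ 2 ≤ E := fun B c hB hc =>
    (hc.rmse_sq_le hV).trans (PolyChaos.InputModel.integral_sub_sum_coeff_sq_le hu hexp hα hdecay
      fun k hk => (not_le.1 fun h => hk
        (hB ((PolyChaos.mem_anisoBasis_decayOrder hL0 k).2 h))).le)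
  refine ⟨PolyChaos.decayOrder d L, PolyChaos.decayOrder_nonneg hL0.le,
    (PolyChaos.card_anisoBasis_decayOrder_le hL0).trans (PolyChaos.exp_mul_decaySum_le hε hε1),
    fun c hc => PolyChaos.InputModel.rrmse_le_of_rmse_sq_le hε.le hV ?_, ?_⟩
  · have := hbest _ c subset_rfl hc
    nlinarith
  intro ν t₀ β κ C _ ht₀ ht₀t _ hκ it R hcard hcoup hsub hcardle hN
  have hβ : 1 ≤ max β 1 := le_max_right _ _
  have hBad : MeasurableSet {x | t < PolyChaos.opNorm (I.gram it.basis it.weight x - 1)} :=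
    measurableSet_lt measurable_const
      (PolyChaos.measurable_opNorm_gram_sub_one I it.basis it.measurable_weight it.numSamples)
  refine ⟨{x | t < PolyChaos.opNorm (I.gram it.basis it.weight x - 1)}ᶜ, hBad.compl, ?_, ?_⟩
  · rcases le_or_gt 0 (C + Real.log (2 * max β 1)) with hC | hC
    · rw [probReal_compl_eq_one_sub hBad]
      have h1 := hcoup.measureReal_lt_opNorm_gram_sub_one_le ht₀ ht₀t ht1.le hcard
      have h2 := PolyChaos.mul_exp_le_exp_neg hβ (PolyChaos.decayRate_pos ht₀t hκ)
        (zero_lt_one.trans_le (R.one_le_mu (Finset.card_pos.1 (by omega)))) hε hcard hcardle hC hN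
      linarith
    -- Here `C < 0`, so `1 - exp (-C)` is not positive and the probability bound is trivial.
    · have h1 : 0 ≤ Real.log (2 * max β 1) := Real.log_nonneg (by linarith)
      have h2 : 1 ≤ Real.exp (-C) := Real.one_le_exp (by linarith)
      exact (sub_nonpos.2 h2).trans measureReal_nonneg
  · intro x hx ctil chat δ hctil hres hη hchat
    have h1 := PolyChaos.InputModel.rmse_surrogate_sq_le_of_residNorm_le hu ht1 (not_lt.1 hx)
      hres hchat.1 hη
    refine PolyChaos.InputModel.rrmse_le_of_rmse_sq_le hε.le hV (h1.trans ?_)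
    exact (mul_le_mul_of_nonneg_left (hbest _ ctil hsub hctil) (by linarith)).trans hEle
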